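/- **Setting.** An instance of the Steiner Tree problem consists of a finite connected undirected graph $G=(V,E)$ with edge costs $c\colon E\to\mathbb{R}_{>0}$ and a nonempty terminal set $R\subseteq V$. $\mathrm{OPT}$ is the minimum cost of a Steiner tree (a tree in $G$ containing all vertices of $R$). $\mathrm{TMST}$ is the minimum cost of a spanning tree of the complete graph on $R$, where the edge $\{x,y\}$ costs the length of a shortest $x$-$y$ path in $(G,c)$. The instance is *MST-optimal* if $\mathrm{TMST}=\mathrm{OPT}$. Let $\vec E$ contain both orientations of every edge of $G$, each of the same cost as the edge, and write $\delta^+(U)$ for the set of directed edges leaving $U\subseteq V$. For a root $r\in R$, the dual of the Bidirected Cut Relaxation asks for $y\in\mathbb{R}_{\ge 0}^{2^V}$ with $\sum_{U:\,e\in\delta^+(U)}y_U\le c(e)$ for all $e\in\vec E$; the value of $y$ is $\sum_{U\subseteq V\setminus\{r\},\,U\cap R\ne\emptyset}y_U$. A directed edge is *tight* if its constraint holds with equality. A *merge plan* is a family $(\mathcal S^t)_{t\ge 0}$ of partitions of $R$ such that for any two distinct $x,y\in R$ there is a time $m\ge 0$ such that $x$ and $y$ are in different parts of $\mathcal S^t$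 if and only if $0\le t\le m$. *Moat growing* with this merge plan starts with $y=0$ at time $t=0$. While there is more than one part, for each part $S$ of the current partition let $U_S$ be the set of vertices reachable from $S$ by a path of tight directed edges; the time $t$ and, simultaneously for all parts $S$, the variables $y_{U_S}$ are increased at unit rate (a variable $y_U$ with $U=U_S$ for several parts $S$ grows at the rate given by the number of these parts) until the partition changes or a new directed edge becomes tight. It outputs $y$ when only one part is left. A dual solution is *merge plan based* if it is the output of moat growing for some merge plan. **Theorem.** For every $\varepsilon>0$ there is an MST-optimal instance with at least two terminals such that, for every choice of the root $r\in R$, every merge plan based dual solution has value at most $\left(\frac{7}{12}+\varepsilon\right)\cdot\mathrm{TMST}$. -/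

import Mathlib

open Finset

/-- An instance of the Steiner Tree problem on a finite vertex set: a connected undirected graph,
positive edge costs (the values of `cost` off the edges play no role) and a nonempty set of
terminals. -/
structure SteinerInstance (V : Type) [Fintype V] where
  graph : SimpleGraph V
  connected : graph.Connected
  cost : Sym2 V → ℝ
  cost_pos : ∀ e ∈ graph.edgeSet, 0 < cost e
  terminals : Finset V
  terminals_nonempty : terminals.Nonempty

/-- A merge plan for the terminal set `R`: a family of partitions of `R` indexed by the times
`t ≥ 0` (values at negative times play no role) such that any two terminals `x`, `y` have a merge
time `m ≥ 0`: they are in different parts of the partition at time `t` iff `0 ≤ t ≤ m`. -/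
structure MergePlan {V : Type} [DecidableEq V] (R : Finset V) where
  part : ℝ → Finpartition R
  exists_mergeTime : ∀ x ∈ R, ∀ y ∈ R, x ≠ y →
    ∃ m : ℝ, 0 ≤ m ∧ ∀ t : ℝ, 0 ≤ t →
      ((¬ ∃ S ∈ (part t).parts, x ∈ S ∧ y ∈ S) ↔ t ≤ m)

namespace SteinerInstance

variable {V : Type} [Fintype V] (I : SteinerInstance V)

/-! ### Steiner trees, terminal spanning trees, MST-optimality -/

/-- The length of a shortest `x`-`y` path. -/
noncomputable def dist (x y : V) : ℝ :=
  ⨅ p : I.graph.Walk x y, (p.edges.map I.cost).sum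

theorem dist_comm (x y : V) : I.dist x y = I.dist y x := by
  unfold dist
  refine Equiv.iInf_congr
    ⟨fun p => p.reverse, fun p => p.reverse, fun p => by simp, fun p => by simp⟩ fun p => ?_
  simp [SimpleGraph.Walk.edges_reverse, List.map_reverse, List.sum_reverse]

/-- The shortest-path distance of the two endpoints of an unordered pair of terminals, that is,
the cost of this pair in the metric closure. -/
noncomputable def closureCost (e : Sym2 I.terminals) : ℝ :=
  Sym2.lift ⟨fun x y : I.terminals => I.dist x y, fun x y => I.dist_comm x y⟩ e

open Classical in
/-- The cost in the metric closure of a graph on the terminals. -/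
noncomputable def terminalGraphCost (T : SimpleGraph I.terminals) : ℝ :=
  ∑ e with e ∈ T.edgeSet, I.closureCost e

/-- The cost of a terminal MST: a minimum cost spanning tree of the complete graph on the
terminals, with respect to the metric closure of the instance. -/
noncomputable def TMST : ℝ :=
  sInf {a : ℝ | ∃ T : SimpleGraph I.terminals, T.IsTree ∧ I.terminalGraphCost T = a}

/-- A Steiner tree: a subgraph that is a tree and contains all terminals. -/
def IsSteinerTree (T : I.graph.Subgraph) : Prop :=
  T.coe.IsTree ∧ ∀ x ∈ I.terminals, x ∈ T.verts

open Classical in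
/-- The cost of a subgraph. -/
noncomputable def subgraphCost (T : I.graph.Subgraph) : ℝ :=
  ∑ e with e ∈ T.edgeSet, I.cost e

/-- The cost of a cheapest Steiner tree. -/
noncomputable def OPT : ℝ :=
  sInf {a : ℝ | ∃ T : I.graph.Subgraph, I.IsSteinerTree T ∧ I.subgraphCost T = a}

/-- A terminal MST is a cheapest Steiner tree. -/
def MSTOptimal : Prop :=
  I.TMST = I.OPT

/-! ### The dual of the Bidirected Cut Relaxation

A dual vector is a function `y : Finset V → ℝ`. The directed edges of the bidirected graph are the
ordered pairs `(v, w)` of adjacent vertices. -/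

variable [DecidableEq V]

/-- The left-hand side of the dual constraint of the directed edge `(v, w)`: the sum of `y U` over
all vertex sets `U` that the edge leaves. -/
def load (y : Finset V → ℝ) (v w : V) : ℝ :=
  ∑ U : Finset V with v ∈ U ∧ w ∉ U, y U

/-- `y` is a solution of the dual program. -/
def DualFeasible (y : Finset V → ℝ) : Prop :=
  (∀ v w, I.graph.Adj v w → load y v w ≤ I.cost s(v, w)) ∧ ∀ U, 0 ≤ y U

/-- The dual objective for the root `r`. -/
def dualValue (r : V) (y : Finset V → ℝ) : ℝ :=
  ∑ U : Finset V with r ∉ U ∧ (U ∩ I.terminals).Nonempty, y U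

/-- The directed edge `(v, w)` is tight: its dual constraint holds with equality. -/
def Tight (y : Finset V → ℝ) (v w : V) : Prop :=
  I.graph.Adj v w ∧ load y v w = I.cost s(v, w)

/-! ### Moat growing with a merge plan -/

open Classical in
/-- The set `U_S` of vertices reachable from `S` by a path of tight directed edges. -/
noncomputable def moat (y : Finset V → ℝ) (S : Finset V) : Finset V :=
  {v | ∃ s ∈ S, Relation.ReflTransGen (I.Tight y) s v}

/-- The growth rate of the dual variables when the moats of all parts of the partition `P` grow at
unit rate: the variable of `U` grows at rate `#{S ∈ P : U_S = U}`. -/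
noncomputable def growthRate (y : Finset V → ℝ) (P : Finpartition I.terminals)
    (U : Finset V) : ℝ :=
  (#{S ∈ P.parts | I.moat y S = U} : ℝ)

/-- `I.Run M t y`: moat growing with merge plan `M` has dual vector `y` at time `t`. The algorithm
starts with `y = 0` at time `0`. Suppose that it has dual vector `y` at time `t` and that the
partition is constant, with more than one part, on the time interval `(t, t']`. Then all `y_{U_S}`
grow at unit rate from time `t` to time `t'`, where the sets `U_S` are those at time `t`; this is
allowed as long as no dual constraint gets violated, that is, as long as no new edge becomes tight
strictly before time `t'`. -/
inductive Run (M : MergePlan I.terminals) : ℝ → (Finset V → ℝ) → Prop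
  | init : Run M 0 0
  | grow {t t' : ℝ} {y : Finset V → ℝ} (hrun : Run M t y) (ht : t < t')
      (hpart : ∀ s, t < s → s ≤ t' → M.part s = M.part t')
      (hcard : 1 < #(M.part t').parts)
      (hfeas : I.DualFeasible fun U => y U + (t' - t) * I.growthRate y (M.part t') U) :
      Run M t' fun U => y U + (t' - t) * I.growthRate y (M.part t') U

/-- Moat growing with merge plan `M` outputs `y`: it has dual vector `y` at some time `T` after
which the partition has only one part. -/
def Output (M : MergePlan I.terminals) (y : Finset V → ℝ) : Prop :=
  ∃ T : ℝ, I.Run M T y ∧ ∀ t, T < t → #(M.part t).parts = 1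

/-- A solution of the dual program that is the output of moat growing for some merge plan. -/
def IsMergePlanBased (y : Finset V → ℝ) : Prop :=
  I.DualFeasible y ∧ ∃ M : MergePlan I.terminals, I.Output M y

/-- Moat growing terminates: for every merge plan it outputs a solution of the dual program. -/
theorem exists_output (M : MergePlan I.terminals) : ∃ y, I.DualFeasible y ∧ I.Output M y := by
  classical
  have hex : ∀ a b : V, ∃ m : ℝ, a ∈ I.terminals → b ∈ I.terminals → a ≠ b →
      ∀ t : ℝ, 0 ≤ t → ((¬ ∃ S ∈ (M.part t).parts, a ∈ S ∧ b ∈ S) ↔ t ≤ m) := by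
    intro a b
    by_cases h : a ∈ I.terminals ∧ b ∈ I.terminals ∧ a ≠ b
    · obtain ⟨m, -, hm⟩ := M.exists_mergeTime a h.1 b h.2.1 h.2.2
      exact ⟨m, fun _ _ _ => hm⟩
    · exact ⟨0, fun h1 h2 h3 => absurd ⟨h1, h2, h3⟩ h⟩
  choose m hm using hex
  -- a part is determined by any of its elements
  have hpartEq : ∀ (P : Finpartition I.terminals) S T (a : V), S ∈ P.parts → T ∈ P.parts →
      a ∈ S → a ∈ T → S = T := by
    intro P S T a hS hT ha hb
    exact P.disjoint.elim_finset hS hT a ha hb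
  have hsub : ∀ P Q : Finpartition I.terminals,
      (∀ a ∈ I.terminals, ∀ b ∈ I.terminals,
        (∃ S ∈ P.parts, a ∈ S ∧ b ∈ S) ↔ ∃ S ∈ Q.parts, a ∈ S ∧ b ∈ S) →
      P.parts ⊆ Q.parts := by
    intro P Q h S hS
    obtain ⟨a, ha⟩ := P.nonempty_of_mem_parts hS
    have haR := P.le hS ha
    obtain ⟨T, hT, haT, -⟩ := (h a haR a haR).1 ⟨S, hS, ha, ha⟩
    have : S = T := by
      ext b
      constructor
      · intro hb
        obtain ⟨U, hU, haU, hbU⟩ := (h a haR b (P.le hS hb)).1 ⟨S, hS, ha, hb⟩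
        rwa [hpartEq Q T U a hT hU haT haU]
      · intro hb
        obtain ⟨U, hU, haU, hbU⟩ := (h a haR b (Q.le hT hb)).2 ⟨T, hT, haT, hb⟩
        rwa [hpartEq P S U a hS hU ha haU]
    rwa [this]
  have hext : ∀ P Q : Finpartition I.terminals,
      (∀ a ∈ I.terminals, ∀ b ∈ I.terminals,
        (∃ S ∈ P.parts, a ∈ S ∧ b ∈ S) ↔ ∃ S ∈ Q.parts, a ∈ S ∧ b ∈ S) → P = Q := by
    intro P Q h
    exact Finpartition.ext
      (Finset.Subset.antisymm (hsub P Q h) (hsub Q P fun a ha b hb => (h a ha b hb).symm))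
  -- the pairs of terminals that are not merged yet, and the directed edges that are not tight yet
  let B : ℝ → Finset (V × V) := fun t =>
    {p | p.1 ∈ I.terminals ∧ p.2 ∈ I.terminals ∧ p.1 ≠ p.2 ∧ t < m p.1 p.2}
  let A : (Finset V → ℝ) → Finset (V × V) := fun y =>
    {p | I.graph.Adj p.1 p.2 ∧ ¬ I.Tight y p.1 p.2}
  have key : ∀ n : ℕ, ∀ t y, 0 ≤ t → I.Run M t y → I.DualFeasible y → #(B t) + #(A y) ≤ n →
      ∃ y, I.DualFeasible y ∧ I.Output M y := by
    intro n
    induction n using Nat.strong_induction_on with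
    | _ n ih =>
    intro t y ht0 hrun hfeas hn
    by_cases hB : (B t).Nonempty
    swap
    · refine ⟨y, hfeas, t, hrun, fun s hs => ?_⟩
      obtain ⟨a, ha⟩ := I.terminals_nonempty
      obtain ⟨S, hS, haS⟩ := (M.part s).exists_mem ha
      rw [Finset.card_eq_one]
      refine ⟨S, Finset.eq_singleton_iff_unique_mem.2 ⟨hS, fun T hT => ?_⟩⟩
      obtain ⟨b, hbT⟩ := (M.part s).nonempty_of_mem_parts hT
      have hb := (M.part s).le hT hbT
      by_cases hab : a = b
      · subst hab; exact hpartEq _ _ _ a hT hS hbT haS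
      have : ¬ s ≤ m a b := by
        intro hle
        exact hB ⟨(a, b), by simp [B, ha, hb, hab]; linarith⟩
      rw [← hm a b ha hb hab s (by linarith), not_not] at this
      obtain ⟨U, hU, haU, hbU⟩ := this
      rw [hpartEq _ _ _ b hT hU hbT hbU, hpartEq _ _ _ a hS hU haS haU]
    -- the next time at which the partition changes
    obtain ⟨p, hp, hpmin⟩ := Finset.exists_min_image (B t) (fun p => m p.1 p.2) hB
    set t1 := m p.1 p.2 with ht1
    simp only [B, Finset.mem_filter, Finset.mem_univ, true_and] at hp
    obtain ⟨hp1, hp2, hp12, htt1⟩ := hp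
    have hconst : ∀ s, t < s → s ≤ t1 → M.part s = M.part t1 := by
      intro s hs hs1
      refine hext _ _ fun a ha b hb => ?_
      by_cases hab : a = b
      · subst hab
        constructor
        · intro _
          obtain ⟨S, hS, h⟩ := (M.part t1).exists_mem ha
          exact ⟨S, hS, h, h⟩
        · intro _
          obtain ⟨S, hS, h⟩ := (M.part s).exists_mem ha
          exact ⟨S, hS, h, h⟩
      rw [← not_iff_not, hm a b ha hb hab s (by linarith), hm a b ha hb hab t1 (by linarith)]
      constructor
      · intro h
        exact hpmin (a, b) (by simp [B, ha, hb, hab]; linarith)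
      · intro h; linarith
    have hcard : 1 < #(M.part t1).parts := by
      obtain ⟨S, hS, haS⟩ := (M.part t1).exists_mem hp1
      obtain ⟨T, hT, hbT⟩ := (M.part t1).exists_mem hp2
      have hsep := (hm _ _ hp1 hp2 hp12 t1 (by linarith)).2 le_rfl
      refine Finset.one_lt_card.2 ⟨S, hS, T, hT, ?_⟩
      rintro rfl
      exact hsep ⟨S, hS, haS, hbT⟩
    set g := I.growthRate y (M.part t1) with hg
    have hg0 : ∀ U, 0 ≤ g U := fun U => Nat.cast_nonneg _
    have hload : ∀ (δ : ℝ) v w, load (fun U => y U + δ * g U) v w = load y v w + δ * load g v w := by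
      intro δ v w
      simp only [load, Finset.sum_add_distrib, Finset.mul_sum]
    have hlg0 : ∀ v w, 0 ≤ load g v w := fun v w => Finset.sum_nonneg fun U _ => hg0 U
    -- the moats are closed under tight edges
    have htight : ∀ v w, I.Tight y v w → load g v w = 0 := by
      intro v w hvw
      refine Finset.sum_eq_zero fun U hU => ?_
      simp only [Finset.mem_filter, Finset.mem_univ, true_and] at hU
      simp only [hg, growthRate, Nat.cast_eq_zero, Finset.card_eq_zero]
      refine Finset.filter_eq_empty_iff.2 fun S _ hSU => ?_
      subst hSU
      simp only [moat, Finset.mem_filter, Finset.mem_univ, true_and] at hU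
      obtain ⟨⟨s, hs, hsv⟩, h⟩ := hU
      exact h ⟨s, hs, hsv.tail hvw⟩
    have hstay : ∀ δ v w, I.Tight y v w → I.Tight (fun U => y U + δ * g U) v w := by
      intro δ v w h
      exact ⟨h.1, by rw [hload, htight v w h, mul_zero, add_zero, h.2]⟩
    have hAsub : ∀ δ, A (fun U => y U + δ * g U) ⊆ A y := by
      intro δ q hq
      simp only [A, Finset.mem_filter, Finset.mem_univ, true_and] at hq ⊢
      exact ⟨hq.1, fun h => hq.2 (hstay δ _ _ h)⟩
    have hBsub : ∀ s, t ≤ s → B s ⊆ B t := by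
      intro s hs q hq
      simp only [B, Finset.mem_filter, Finset.mem_univ, true_and] at hq ⊢
      exact ⟨hq.1, hq.2.1, hq.2.2.1, by linarith [hq.2.2.2]⟩
    have hstep : ∀ δ, 0 < δ → δ ≤ t1 - t →
        (∀ v w, I.graph.Adj v w → load y v w + δ * load g v w ≤ I.cost s(v, w)) →
        I.Run M (t + δ) (fun U => y U + δ * g U) ∧ I.DualFeasible (fun U => y U + δ * g U) := by
      intro δ hδ hδ1 hle
      have hP : M.part (t + δ) = M.part t1 := hconst _ (by linarith) (by linarith)
      have hf : I.DualFeasible (fun U => y U + δ * g U) :=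
        ⟨fun v w h => by rw [hload]; exact hle v w h,
          fun U => add_nonneg (hfeas.2 U) (mul_nonneg hδ.le (hg0 U))⟩
      have h := Run.grow (t' := t + δ) hrun (by linarith)
        (fun s hs hs' => by rw [hP]; exact hconst s hs (by linarith))
        (by rw [hP]; exact hcard)
        (by simpa only [hP, add_sub_cancel_left] using hf)
      simp only [hP, add_sub_cancel_left] at h
      exact ⟨h, hf⟩
    let C : Finset (V × V) := {q | I.graph.Adj q.1 q.2 ∧ 0 < load g q.1 q.2}
    by_cases hall : ∀ q ∈ C, (t1 - t) * load g q.1 q.2 ≤ I.cost s(q.1, q.2) - load y q.1 q.2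
    · -- the partition changes next
      obtain ⟨h1, h2⟩ := hstep (t1 - t) (by linarith) le_rfl fun v w hvw => by
        rcases (hlg0 v w).eq_or_lt with h | h
        · rw [← h, mul_zero, add_zero]; exact hfeas.1 v w hvw
        · have := hall (v, w) (by simp [C, hvw, h])
          simp only at this
          linarith
      refine ih _ ?_ _ _ (by linarith) h1 h2 le_rfl
      have hlt : #(B (t + (t1 - t))) < #(B t) := by
        refine Finset.card_lt_card ⟨hBsub _ (by linarith), fun hss => ?_⟩
        have : p ∈ B (t + (t1 - t)) := hss (by
          simp [B, hp1, hp2, hp12, ← ht1]; linarith)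
        simp [B, ← ht1] at this
      have := Finset.card_le_card (hAsub (t1 - t))
      omega
    · -- a new edge becomes tight next
      push Not at hall
      obtain ⟨q0, hq0, hq0lt⟩ := hall
      obtain ⟨q, hq, hqmin⟩ := Finset.exists_min_image C
        (fun q => (I.cost s(q.1, q.2) - load y q.1 q.2) / load g q.1 q.2) ⟨q0, hq0⟩
      set δ := (I.cost s(q.1, q.2) - load y q.1 q.2) / load g q.1 q.2 with hδ
      have hmemC : ∀ q ∈ C, I.graph.Adj q.1 q.2 ∧ 0 < load g q.1 q.2 := by
        intro q hq; simpa [C] using hq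
      obtain ⟨hadj, hpos⟩ := hmemC q hq
      have hnt : ¬ I.Tight y q.1 q.2 := fun h => by
        rw [htight _ _ h] at hpos; exact lt_irrefl _ hpos
      have hδ0 : 0 < δ := by
        refine div_pos (sub_pos.2 (lt_of_le_of_ne (hfeas.1 _ _ hadj) fun h => hnt ⟨hadj, h⟩)) hpos
      have hδ1 : δ ≤ t1 - t := by
        refine (hqmin q0 hq0).trans ?_
        rw [div_le_iff₀ (hmemC q0 hq0).2]
        exact hq0lt.le
      obtain ⟨h1, h2⟩ := hstep δ hδ0 hδ1 fun v w hvw => by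
        rcases (hlg0 v w).eq_or_lt with h | h
        · rw [← h, mul_zero, add_zero]; exact hfeas.1 v w hvw
        · have := hqmin (v, w) (by simp [C, hvw, h])
          simp only at this
          rw [le_div_iff₀ h] at this
          linarith
      refine ih _ ?_ _ _ (by linarith) h1 h2 le_rfl
      have hlt : #(A fun U => y U + δ * g U) < #(A y) := by
        refine Finset.card_lt_card ⟨hAsub _, fun hss => ?_⟩
        have : q ∈ A fun U => y U + δ * g U := hss (by simp [A, hadj, hnt])
        simp only [A, Finset.mem_filter, Finset.mem_univ, true_and] at this
        refine this.2 ⟨hadj, ?_⟩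
        rw [hload, hδ, div_mul_cancel₀ _ hpos.ne']
        ring
      have := Finset.card_le_card (hBsub (t + δ) (by linarith))
      omega
  refine key _ 0 0 le_rfl Run.init ⟨fun v w h => ?_, fun U => le_rfl⟩ le_rfl
  simp only [load, Pi.zero_apply, Finset.sum_const_zero]
  exact (I.cost_pos s(v, w) h).le

end SteinerInstance

/-! A single family of MST-optimal instances defeats all merge plans. There are `n` terminals, any
two of them joined by an edge of cost `12 N`, where `N` is large. In addition, there is a gadget
for any pair of a *helper* `i` and a terminal `j`. It consists of a spine, which is a path whose
edges cost 1, and of arms that lead to the spine: one from `j` to every position on the spine, and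
one from each terminal `k` to a position of its own. Entering an arm at its foot costs about
`6 N`, and the arm has length `3 N`. The helper is joined to almost all vertices of its gadgets, at
costs between `6 N` and `7 N + 1`.

**Moat growing is fast.** The moat of the helper reaches a valley of an arm just early enough to
make the next edge of the arm tight, in the direction from the foot to the spine, by the time that
the moat of the foot arrives there. Two thirds of the length of an arm is thus free for this moat,
which travels at triple speed and arrives at the spine at time about `7 N` instead of `9 N`. The
same happens on the spine: in the direction to its last vertex `w`, the edges from outer to inner
vertices are made tight by the helper, and those from inner to outer vertices by the moat of `j`,
as long as it has not been merged with the one of the helper. Since the last edge of each arm of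
the second kind is slightly longer, all moats find the spine tight and contain `w` at time
`7 N + 6` (`arrivesBy_last`). For this, no moat may use the edges in an unintended way before time
`7 N + 3`. This is verified by a certificate: claimed lower bounds on arrival times (`lower`) and known
upper bounds (`upper`) bound the load of each directed edge, and the lower bounds are correct if
these loads do not make an edge tight too soon (`le_of_reflTransGen_tight`, `loadBound_lt`).

**Consequence for the value.** Let the helper be the root `r`, and suppose that `j` is still
separated from `r` at time `7 N + 6`; if there is no such `j`, then the value does not grow after
this time. Every moat that does not contain `r` loads the edge `(w, r)` from then on, whose cost
is `7 N`. So the value is at most `(n - 1) (7 N + 6) + 7 N` (`Run.dualValue_le_of_arrivesBy`,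
`dualValue_le`), whereas `TMST = 12 N (n - 1)`.

**The gadgets do not help a Steiner tree.** A component of a Steiner tree without its terminals
lies in one gadget. If it is joined to a set `X` of terminals, then it pays `6 N` for each of
them, `3 N` for the arm of each but the helper, and `4 N` on the spine between any two consecutive
arms of terminals other than `i` and `j`, unless at most two terminals are involved. This is at
least `12 N (#X - 1)` (`comp_cost_ge`), so that the component can be replaced by a star of direct
edges (`cost_ge_of_connected`). -/

/-! ### Moat growing -/

namespace SteinerInstance

section Merged

variable {V : Type} [DecidableEq V] {R : Finset V} {M : MergePlan R}

/-- The two terminals are in the same part at all times after `t`. -/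
def Merged (M : MergePlan R) (t : ℝ) (x z : V) : Prop :=
  ∀ s, t < s → ∃ S ∈ (M.part s).parts, x ∈ S ∧ z ∈ S

theorem Merged.mono {s t : ℝ} (hst : s ≤ t) {x z : V}
    (h : Merged M s x z) : Merged M t x z :=
  fun r hr => h r (hst.trans_lt hr)

theorem Merged.refl (M : MergePlan R) (t : ℝ) {x : V} (hx : x ∈ R) :
    Merged M t x x := fun s _ => by
  obtain ⟨S, hS, h⟩ := (M.part s).exists_mem hx
  exact ⟨S, hS, h, h⟩

end Merged

variable {V : Type} [Fintype V] (I : SteinerInstance V) [DecidableEq V]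

/-- If `y` is the dual vector at time `t`, then `I.Covers M t y x v` says that `v` belongs to the
moat of the part that contains the terminal `x` immediately after time `t`. -/
def Covers (M : MergePlan I.terminals) (t : ℝ) (y : Finset V → ℝ) (x v : V) : Prop :=
  ∃ z ∈ I.terminals, Merged M t x z ∧ Relation.ReflTransGen (I.Tight y) z v

/-- One step of moat growing, from the dual vector `y` at time `t` to `y'` at time `t'`. -/
structure GrowthStep (M : MergePlan I.terminals) (t t' : ℝ) (y y' : Finset V → ℝ) : Prop where
  run : I.Run M t y
  lt : t < t'
  part_eq : ∀ s, t < s → s ≤ t' → M.part s = M.part t'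
  one_lt_card : 1 < #(M.part t').parts
  feasible : I.DualFeasible y'
  eq : y' = fun U => y U + (t' - t) * I.growthRate y (M.part t') U

variable {I}
variable {M : MergePlan I.terminals} {t t' : ℝ} {y y' : Finset V → ℝ}

theorem GrowthStep.run' (h : I.GrowthStep M t t' y y') : I.Run M t' y' := by
  have hf := h.feasible
  rw [h.eq] at hf ⊢
  exact Run.grow h.run h.lt h.part_eq h.one_lt_card hf

theorem Run.growthStep_induction {P : ℝ → (Finset V → ℝ) → Prop} (h0 : P 0 0)
    (hs : ∀ t t' y y', I.GrowthStep M t t' y y' → P t y → P t' y') {T : ℝ} {y : Finset V → ℝ}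
    (h : I.Run M T y) : P T y := by
  induction h with
  | init => exact h0
  | grow hrun ht hpart hcard hfeas ih => exact hs _ _ _ _ ⟨hrun, ht, hpart, hcard, hfeas, rfl⟩ ih

theorem Run.nonneg (h : I.Run M t y) : 0 ≤ t :=
  h.growthStep_induction (P := fun t _ => 0 ≤ t) le_rfl fun _ _ _ _ h ih => ih.trans h.lt.le

theorem Run.dualFeasible (h : I.Run M t y) : I.DualFeasible y := by
  refine h.growthStep_induction (P := fun _ y => I.DualFeasible y)
    ⟨fun v w h => ?_, fun U => le_rfl⟩ fun _ _ _ _ h _ => h.feasible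
  simpa [load] using (I.cost_pos s(v, w) h).le

theorem Run.load_nonneg (h : I.Run M t y) (u v : V) : 0 ≤ load y u v :=
  Finset.sum_nonneg fun U _ => h.dualFeasible.2 U

/-- The growth rates of a family of vertex sets sum to the number of moats in this family. -/
theorem sum_growthRate (y : Finset V → ℝ) (P : Finpartition I.terminals) (F : Finset (Finset V)) :
    ∑ U ∈ F, I.growthRate y P U = (#{S ∈ P.parts | I.moat y S ∈ F} : ℝ) := by
  classical
  have hmaps : Set.MapsTo (I.moat y) ({S ∈ P.parts | I.moat y S ∈ F} : Finset _) F :=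
    fun S hS => (Finset.mem_filter.1 (Finset.mem_coe.1 hS)).2
  rw [Finset.card_eq_sum_card_fiberwise hmaps]
  push_cast
  refine Finset.sum_congr rfl fun U hU => ?_
  rw [growthRate, Finset.filter_filter]
  congr 2
  ext S
  simp only [Finset.mem_filter]
  constructor
  · rintro ⟨h1, rfl⟩; exact ⟨h1, hU, rfl⟩
  · rintro ⟨h1, _, h2⟩; exact ⟨h1, h2⟩

theorem GrowthStep.sum_eq (h : I.GrowthStep M t t' y y') (F : Finset (Finset V)) :
    ∑ U ∈ F, y' U = ∑ U ∈ F, y U +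
      (t' - t) * (#{S ∈ (M.part t').parts | I.moat y S ∈ F} : ℝ) := by
  rw [← sum_growthRate, h.eq, Finset.sum_add_distrib, Finset.mul_sum]

theorem GrowthStep.load_eq (h : I.GrowthStep M t t' y y') (u v : V) :
    load y' u v = load y u v +
      (t' - t) * (#{S ∈ (M.part t').parts | u ∈ I.moat y S ∧ v ∉ I.moat y S} : ℝ) := by
  rw [load, load, h.sum_eq]
  simp

theorem GrowthStep.load_le (h : I.GrowthStep M t t' y y') (u v : V) :
    load y u v ≤ load y' u v := by
  rw [h.load_eq]
  have := h.lt
  have : 0 ≤ (t' - t) * (#{S ∈ (M.part t').parts | u ∈ I.moat y S ∧ v ∉ I.moat y S} : ℝ) :=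
    mul_nonneg (by linarith) (Nat.cast_nonneg _)
  linarith

theorem GrowthStep.tight (h : I.GrowthStep M t t' y y') {u v : V} (ht : I.Tight y u v) :
    I.Tight y' u v :=
  ⟨ht.1, le_antisymm (h.feasible.1 u v ht.1) (ht.2 ▸ h.load_le u v)⟩

/-- Terminals that share a part during a growth step stay together, since merge plans never
separate merged terminals again. -/
theorem GrowthStep.merged_iff (h : I.GrowthStep M t t' y y') {x z : V} (hx : x ∈ I.terminals)
    (hz : z ∈ I.terminals) :
    Merged M t x z ↔ ∃ S ∈ (M.part t').parts, x ∈ S ∧ z ∈ S := by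
  refine ⟨fun hm => hm t' h.lt, fun hS s hs => ?_⟩
  rcases le_or_gt s t' with hst | hst
  · rwa [h.part_eq s hs hst]
  · by_cases hxz : x = z
    · subst hxz; exact Merged.refl M t hx s hs
    obtain ⟨m, -, hm⟩ := M.exists_mergeTime x hx z hz hxz
    have h0 := h.run.nonneg
    have h1 := h.lt
    have h2 : ¬ t' ≤ m := by
      rw [← hm t' (by linarith), not_not]; exact hS
    by_contra hcon
    exact h2 (hst.le.trans ((hm s (by linarith)).1 hcon))

theorem GrowthStep.mem_moat_iff (h : I.GrowthStep M t t' y y') {S : Finset V}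
    (hS : S ∈ (M.part t').parts) {x : V} (hx : x ∈ S) (v : V) :
    v ∈ I.moat y S ↔ I.Covers M t y x v := by
  have hxR := (M.part t').le hS hx
  simp only [moat, Finset.mem_filter, Finset.mem_univ, true_and, Covers]
  constructor
  · rintro ⟨z, hz, hr⟩
    have hzR := (M.part t').le hS hz
    exact ⟨z, hzR, (h.merged_iff hxR hzR).2 ⟨S, hS, hx, hz⟩, hr⟩
  · rintro ⟨z, hzR, hm, hr⟩
    obtain ⟨S', hS', hx', hz⟩ := (h.merged_iff hxR hzR).1 hm
    rw [(M.part t').disjoint.elim_finset hS hS' x hx hx']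
    exact ⟨z, hz, hr⟩

theorem Covers.tail {x u v : V} (h : I.Covers M t y x u) (ht : I.Tight y u v) :
    I.Covers M t y x v := by
  obtain ⟨z, hz, hm, hr⟩ := h
  exact ⟨z, hz, hm, hr.tail ht⟩

theorem GrowthStep.covers (h : I.GrowthStep M t t' y y') {x v : V} (hc : I.Covers M t y x v) :
    I.Covers M t' y' x v := by
  obtain ⟨z, hz, hm, hr⟩ := hc
  refine ⟨z, hz, hm.mono h.lt.le, ?_⟩
  induction hr with
  | refl => exact .refl
  | tail _ huv ih => exact ih.tail (h.tight huv)

/-- A directed edge that leaves the moat of some terminal is loaded at least at unit rate. -/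
theorem GrowthStep.load_add_le (h : I.GrowthStep M t t' y y') {x u v : V} (hx : x ∈ I.terminals)
    (hu : I.Covers M t y x u) (hv : ¬ I.Covers M t y x v) :
    load y u v + (t' - t) ≤ load y' u v := by
  rw [h.load_eq]
  obtain ⟨S, hS, hxS⟩ := (M.part t').exists_mem hx
  have : (1 : ℝ) ≤ (#{S ∈ (M.part t').parts | u ∈ I.moat y S ∧ v ∉ I.moat y S} : ℝ) := by
    rw [Nat.one_le_cast]
    refine Finset.card_pos.2 ⟨S, Finset.mem_filter.2 ⟨hS, ?_⟩⟩
    rw [h.mem_moat_iff hS hxS, h.mem_moat_iff hS hxS]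
    exact ⟨hu, hv⟩
  nlinarith [h.lt]

/-- A growth step can be interrupted at any time in its interior, and the moats at that time are
those at the start of the step. -/
theorem GrowthStep.interior (h : I.GrowthStep M t t' y y') {σ : ℝ} (h1 : t < σ) (h2 : σ < t') :
    ∃ z, I.Run M σ z ∧ ∀ x ∈ I.terminals, ∀ v, I.Covers M σ z x v → I.Covers M t y x v := by
  have hP : M.part σ = M.part t' := h.part_eq σ h1 h2.le
  have hloadσ : ∀ u v, load (fun U => y U + (σ - t) * I.growthRate y (M.part σ) U) u v =
      load y u v + (σ - t) *
        (#{S ∈ (M.part t').parts | u ∈ I.moat y S ∧ v ∉ I.moat y S} : ℝ) := by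
    intro u v
    rw [hP, load, load, Finset.sum_add_distrib, ← Finset.mul_sum, sum_growthRate]
    simp
  have hstep : I.GrowthStep M t σ y
      fun U => y U + (σ - t) * I.growthRate y (M.part σ) U := by
    refine ⟨h.run, h1, fun s hs hs' => ?_, hP ▸ h.one_lt_card,
      ⟨fun u v huv => ?_, fun U => ?_⟩, rfl⟩
    · rw [hP, h.part_eq s hs (hs'.trans h2.le)]
    · have hf := h.feasible.1 u v huv
      rw [h.load_eq] at hf
      rw [hloadσ]
      refine le_trans ?_ hf
      gcongr
    · exact add_nonneg (h.run.dualFeasible.2 U) (mul_nonneg (by linarith) (Nat.cast_nonneg _))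
  refine ⟨_, hstep.run', fun x hx v hc => ?_⟩
  obtain ⟨z, hz, hm, hr⟩ := hc
  have hm' : Merged M t x z := by
    rw [h.merged_iff hx hz]; exact hm t' h2
  obtain ⟨S, hS, hxS, hzS⟩ := (h.merged_iff hx hz).1 hm'
  induction hr with
  | refl => exact ⟨z, hz, hm', .refl⟩
  | @tail u w _ huw ih =>
    -- otherwise the edge would be overloaded at the end of the step
    by_contra hw
    have hlt : (1 : ℝ) ≤ (#{S ∈ (M.part t').parts | u ∈ I.moat y S ∧ w ∉ I.moat y S} : ℝ) := by
      rw [Nat.one_le_cast]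
      refine Finset.card_pos.2 ⟨S, Finset.mem_filter.2 ⟨hS, ?_⟩⟩
      rw [h.mem_moat_iff hS hxS, h.mem_moat_iff hS hxS]
      exact ⟨ih, hw⟩
    have h3 := huw.2
    rw [hloadσ] at h3
    have h4 := h.feasible.1 u w huw.1
    rw [h.load_eq] at h4
    nlinarith

/-! ### Arrival times of moats -/

variable (I) in
/-- From time `σ` on, the moat of the part of `x` contains `v`. -/
def ArrivesBy (M : MergePlan I.terminals) (x v : V) (σ : ℝ) : Prop :=
  ∀ t y, I.Run M t y → σ ≤ t → I.Covers M t y x v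

variable {x u v : V} {σ τ : ℝ}

theorem arrivesBy_self (hx : x ∈ I.terminals) : I.ArrivesBy M x x σ :=
  fun t _ _ _ => ⟨x, hx, Merged.refl M t hx, .refl⟩

theorem ArrivesBy.mono (h : I.ArrivesBy M x v σ) (hστ : σ ≤ τ) : I.ArrivesBy M x v τ :=
  fun t y hr ht => h t y hr (hστ.trans ht)

/-- The moats do not change inside a growth step, so that an arrival before its end already
happened at its start. -/
theorem GrowthStep.covers_of_arrivesBy (h : I.GrowthStep M t t' y y') (hx : x ∈ I.terminals)
    (ha : I.ArrivesBy M x v σ) (hσ : σ < t') : I.Covers M t y x v := by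
  rcases le_or_gt σ t with h1 | h1
  · exact ha t y h.run h1
  · obtain ⟨z, hz, hc⟩ := h.interior h1 hσ
    exact hc x hx v (ha σ z hz le_rfl)

/-- Between the arrivals of a moat at `u` and at `v`, the edge `(u, v)` is loaded. -/
theorem ArrivesBy.le_load (hx : x ∈ I.terminals) (hσ : 0 ≤ σ) (ha : I.ArrivesBy M x u σ)
    (hv : ∀ t y, I.Run M t y → t < τ → ¬ I.Covers M t y x v) {T : ℝ} {y : Finset V → ℝ}
    (hr : I.Run M T y) : min T τ - σ ≤ load y u v := by
  refine hr.growthStep_induction (P := fun T y => min T τ - σ ≤ load y u v) ?_ ?_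
  · have := min_le_left 0 τ
    simp only [load, Pi.zero_apply, Finset.sum_const_zero]
    linarith
  · intro t t' y y' h ih
    have hload := h.load_le u v
    rcases le_or_gt (min t' τ) σ with h1 | h1
    · have := h.run'.load_nonneg u v
      linarith
    rcases le_or_gt τ t with h2 | h2
    · rw [min_eq_right h2] at ih
      have := min_le_right t' τ
      linarith
    · have := h.load_add_le hx (h.covers_of_arrivesBy hx ha (h1.trans_le (min_le_left _ _)))
        (hv t y h.run h2)
      have := min_le_left t' τ
      rw [min_eq_left h2.le] at ih
      linarith

/-- A moat crosses an edge at least at unit speed. -/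
theorem ArrivesBy.adj (hx : x ∈ I.terminals) (hσ : 0 ≤ σ) (ha : I.ArrivesBy M x u σ)
    (huv : I.graph.Adj u v) : I.ArrivesBy M x v (σ + I.cost s(u, v)) := by
  have hcost := I.cost_pos s(u, v) huv
  intro T y hr hT
  have key : I.Covers M T y x v ∨ T - σ ≤ load y u v := by
    refine hr.growthStep_induction
      (P := fun T y => I.Covers M T y x v ∨ T - σ ≤ load y u v) ?_ ?_
    · right
      simp only [load, Pi.zero_apply, Finset.sum_const_zero]
      linarith
    · intro t t' y y' h ih
      by_cases hc : I.Covers M t y x v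
      · exact Or.inl (h.covers hc)
      right
      rcases le_or_gt t' σ with h1 | h1
      · have := h.run'.load_nonneg u v
        linarith
      · have := h.load_add_le hx (h.covers_of_arrivesBy hx ha h1) hc
        have := ih.resolve_left hc
        linarith
  refine key.elim id fun hl => ?_
  refine (ha T y hr (by linarith)).tail ⟨huv, le_antisymm (hr.dualFeasible.1 u v huv) ?_⟩
  linarith

/-- Moats cross tight edges instantly. -/
theorem ArrivesBy.of_tight (ha : I.ArrivesBy M x u σ)
    (htight : ∀ t y, I.Run M t y → σ ≤ t → I.Tight y u v) : I.ArrivesBy M x v σ :=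
  fun t y hr ht => (ha t y hr ht).tail (htight t y hr ht)

/-- An edge becomes tight if some moat loads it for long enough: it suffices that this moat arrives
at the tail of the edge and does not reach its head in other ways in the meantime. -/
theorem ArrivesBy.tight (hx : x ∈ I.terminals) (hσ : 0 ≤ σ) (ha : I.ArrivesBy M x u σ)
    (huv : I.graph.Adj u v)
    (hv : ∀ t y, I.Run M t y → t < σ + I.cost s(u, v) → ¬ I.Covers M t y x v)
    {T : ℝ} {y : Finset V → ℝ} (hr : I.Run M T y) (hT : σ + I.cost s(u, v) ≤ T) :
    I.Tight y u v := by
  have := ha.le_load hx hσ hv hr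
  rw [min_eq_right hT] at this
  exact ⟨huv, le_antisymm (hr.dualFeasible.1 u v huv) (by linarith)⟩

/-- A certificate for lower bounds on arrival times up to time `t₁`. The lower bound on the arrival
time of the moat of `z` at `u` is `a z u`, and `τ z v` is an upper bound on the arrival time at `v`
that is known already. Then `(u, v)` is loaded on account of `z` at most between the times `a z u`
and `τ z v`, and the lower bounds are correct if these loads do not make any edge tight too soon. -/
theorem le_of_reflTransGen_tight {a τ : V → V → ℝ} {t₁ : ℝ}
    (hτ : ∀ z ∈ I.terminals, ∀ v, τ z v < t₁ → I.ArrivesBy M z v (τ z v))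
    (ha : ∀ x ∈ I.terminals, a x x ≤ 0)
    (hload : ∀ u v, I.graph.Adj u v → ∀ x ∈ I.terminals, ∀ t, 0 ≤ t → t < t₁ →
      a x u ≤ t → t < a x v →
      ∑ z ∈ I.terminals, max 0 (min t (τ z v) - a z u) < I.cost s(u, v))
    {T : ℝ} {y : Finset V → ℝ} (hr : I.Run M T y) (hT : T < t₁) {x v : V}
    (hx : x ∈ I.terminals) (hv : Relation.ReflTransGen (I.Tight y) x v) : a x v ≤ T := by
  have hreach : ∀ t y, I.Run M t y → t < t₁ →
      (∀ u v, load y u v ≤ ∑ z ∈ I.terminals, max 0 (min t (τ z v) - a z u)) →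
      ∀ x ∈ I.terminals, ∀ v, Relation.ReflTransGen (I.Tight y) x v → a x v ≤ t := by
    intro t y hr ht hl x hx v hv
    induction hv with
    | refl => exact (ha x hx).trans hr.nonneg
    | @tail u w _ huw ih =>
      by_contra! hcon
      have h1 := hload u w huw.1 x hx t hr.nonneg ht ih hcon
      have h2 := hl u w
      rw [huw.2] at h2
      exact absurd (h2.trans_lt h1) (lt_irrefl _)
  have hl : T ≤ t₁ → ∀ u v, load y u v ≤ ∑ z ∈ I.terminals, max 0 (min T (τ z v) - a z u) := by
    refine hr.growthStep_induction (P := fun T y => T ≤ t₁ → ∀ u v, load y u v ≤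
      ∑ z ∈ I.terminals, max 0 (min T (τ z v) - a z u)) ?_ ?_
    · intro _ u v
      simp only [load, Pi.zero_apply, Finset.sum_const_zero]
      exact Finset.sum_nonneg fun _ _ => le_max_left _ _
    · intro t t' y y' h ih ht' u v
      have htt := h.lt
      have hR := hreach t y h.run (by linarith) (ih (by linarith))
      specialize ih (by linarith) u v
      -- every part that loads the edge has a terminal that accounts for it
      set Z := {z ∈ I.terminals | a z u ≤ t ∧ t' ≤ τ z v} with hZ
      have hex : ∀ S, S ∈ {S ∈ (M.part t').parts | u ∈ I.moat y S ∧ v ∉ I.moat y S} →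
          ∃ z ∈ S, z ∈ Z := by
        intro S hS
        obtain ⟨hS, hu, hv⟩ := Finset.mem_filter.1 hS
        have hu' := hu
        simp only [moat, Finset.mem_filter, Finset.mem_univ, true_and] at hu'
        obtain ⟨z, hz, hzu⟩ := hu'
        have hzR := (M.part t').le hS hz
        refine ⟨z, hz, Finset.mem_filter.2 ⟨hzR, hR z hzR u hzu, ?_⟩⟩
        by_contra! hlt
        rw [h.mem_moat_iff hS hz] at hv
        exact hv (h.covers_of_arrivesBy hzR (hτ z hzR v (by linarith)) hlt)
      have hcard : #{S ∈ (M.part t').parts | u ∈ I.moat y S ∧ v ∉ I.moat y S} ≤ #Z := by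
        have : Nonempty V := ⟨u⟩
        choose! f hf using hex
        refine Finset.card_le_card_of_injOn f (fun S hS => (hf S hS).2) fun S hS S' hS' he => ?_
        have h1 := (hf S hS).1
        rw [he] at h1
        exact (M.part t').disjoint.elim_finset (Finset.mem_filter.1 hS).1
          (Finset.mem_filter.1 hS').1 _ h1 (hf S' hS').1
      have hsum : ∑ z ∈ I.terminals, max 0 (min t (τ z v) - a z u) + (t' - t) * (#Z : ℝ) ≤
          ∑ z ∈ I.terminals, max 0 (min t' (τ z v) - a z u) := by
        rw [mul_comm, ← nsmul_eq_mul, ← Finset.sum_const, hZ, Finset.sum_filter,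
          ← Finset.sum_add_distrib]
        refine Finset.sum_le_sum fun z _ => ?_
        split_ifs with hz
        · rw [min_eq_left (by linarith), min_eq_left hz.2, max_eq_right (by linarith),
            max_eq_right (by linarith)]
          linarith
        · rw [add_zero]
          gcongr
      rw [h.load_eq]
      refine le_trans ?_ hsum
      have : (#{S ∈ (M.part t').parts | u ∈ I.moat y S ∧ v ∉ I.moat y S} : ℝ) ≤ #Z :=
        Nat.cast_le.2 hcard
      nlinarith
  exact hreach T y hr hT (hl hT.le) x hx v hv

/-! ### The value of the dual solution -/

theorem GrowthStep.dualValue_eq (h : I.GrowthStep M t t' y y') {r : V} :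
    I.dualValue r y' = I.dualValue r y +
      (t' - t) * (#{S ∈ (M.part t').parts | r ∉ I.moat y S} : ℝ) := by
  rw [dualValue, dualValue, h.sum_eq]
  congr 4
  ext S
  simp only [Finset.mem_filter, Finset.mem_univ, true_and, and_congr_right_iff,
    and_iff_left_iff_imp]
  intro hS _
  obtain ⟨x, hx⟩ := (M.part t').nonempty_of_mem_parts hS
  refine ⟨x, Finset.mem_inter.2 ⟨?_, (M.part t').le hS hx⟩⟩
  simp only [moat, Finset.mem_filter, Finset.mem_univ, true_and]
  exact ⟨x, hx, .refl⟩

theorem card_moats_le (P : Finpartition I.terminals) (y : Finset V → ℝ) {r : V}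
    (hr : r ∈ I.terminals) :
    (#{S ∈ P.parts | r ∉ I.moat y S} : ℝ) ≤ #I.terminals - 1 := by
  obtain ⟨S, hS, hrS⟩ := P.exists_mem hr
  have h1 : #{S ∈ P.parts | r ∉ I.moat y S} < #P.parts := by
    refine Finset.card_lt_card (Finset.filter_ssubset.2 ⟨S, hS, not_not.2 ?_⟩)
    simp only [moat, Finset.mem_filter, Finset.mem_univ, true_and]
    exact ⟨r, hrS, .refl⟩
  have h2 := P.card_parts_le_card
  have h3 : ((#{S ∈ P.parts | r ∉ I.moat y S} + 1 : ℕ) : ℝ) ≤ #I.terminals :=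
    Nat.cast_le.2 (by omega)
  push_cast at h3
  linarith

theorem Run.dualValue_le (h : I.Run M t y) {r : V} (hr : r ∈ I.terminals) :
    I.dualValue r y ≤ (#I.terminals - 1) * t := by
  refine h.growthStep_induction (P := fun t y => I.dualValue r y ≤ (#I.terminals - 1) * t) ?_ ?_
  · simp [dualValue]
  · intro t t' y y' h ih
    have h1 := card_moats_le (M.part t') y hr
    have h2 := h.lt
    rw [h.dualValue_eq]
    nlinarith

/-- Once all moats contain the tail of an edge `(w, r)` into the root, all of them that do not
contain the root load this edge, so that the value cannot grow by more than its cost. It suffices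
that this arrival happens if there are moats without the root at the time `t₀` or later. -/
theorem Run.dualValue_le_of_arrivesBy (h : I.Run M t y) {r : V} (hr : r ∈ I.terminals) {t₀ c : ℝ}
    (ht₀ : 0 ≤ t₀) (hc : 0 ≤ c)
    (harr : ∀ j ∈ I.terminals, (∀ s < t₀, ¬ Merged M s j r) → ∃ w, I.graph.Adj w r ∧
      I.cost s(w, r) ≤ c ∧ ∀ k ∈ I.terminals, I.ArrivesBy M k w t₀) :
    I.dualValue r y ≤ (#I.terminals - 1) * t₀ + c := by
  have hcard : (0 : ℝ) ≤ #I.terminals - 1 := by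
    have : 1 ≤ #I.terminals := Finset.card_pos.2 ⟨r, hr⟩
    have : (1 : ℝ) ≤ #I.terminals := by exact_mod_cast this
    linarith
  refine h.growthStep_induction
    (P := fun t y => I.dualValue r y ≤ (#I.terminals - 1) * t₀ + c) ?_ ?_
  · simp only [dualValue, Pi.zero_apply, Finset.sum_const_zero]
    positivity
  intro t t' y y' h ih
  rcases le_or_gt t' t₀ with ht' | ht'
  · have := h.run'.dualValue_le hr
    nlinarith
  rcases Finset.eq_empty_or_nonempty {S ∈ (M.part t').parts | r ∉ I.moat y S} with he | ⟨S, hS⟩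
  · rwa [h.dualValue_eq, he, Finset.card_empty, Nat.cast_zero, mul_zero, add_zero]
  obtain ⟨hS, hrS⟩ := Finset.mem_filter.1 hS
  obtain ⟨j, hj⟩ := (M.part t').nonempty_of_mem_parts hS
  have hjR := (M.part t').le hS hj
  rw [h.mem_moat_iff hS hj] at hrS
  obtain ⟨w, hadj, hcost, hw⟩ := harr j hjR fun s hs hm => by
    refine hrS ⟨r, hr, ?_, .refl⟩
    rw [h.merged_iff hjR hr]
    exact hm t' (hs.trans ht')
  have hval : ∀ t y, I.Run M t y →
      I.dualValue r y ≤ (#I.terminals - 1) * min t t₀ + load y w r := by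
    intro t y hrun
    refine hrun.growthStep_induction
      (P := fun t y => I.dualValue r y ≤ (#I.terminals - 1) * min t t₀ + load y w r) ?_ ?_
    · simp [dualValue, load, min_eq_left ht₀]
    intro t t' y y' h ih
    rcases le_or_gt t' t₀ with ht' | ht'
    · rw [min_eq_left ht']
      have := h.run'.dualValue_le hr
      have := h.run'.load_nonneg w r
      linarith
    · have h1 : {S ∈ (M.part t').parts | r ∉ I.moat y S} =
          {S ∈ (M.part t').parts | w ∈ I.moat y S ∧ r ∉ I.moat y S} := by
        refine Finset.filter_congr fun S hS => ?_
        obtain ⟨k, hk⟩ := (M.part t').nonempty_of_mem_parts hS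
        have hkR := (M.part t').le hS hk
        have := h.covers_of_arrivesBy hkR (hw k hkR) ht'
        rw [← h.mem_moat_iff hS hk] at this
        simp [this]
      rw [h.dualValue_eq, h.load_eq, h1]
      have : min t t₀ ≤ min t' t₀ := min_le_min_right _ h.lt.le
      nlinarith
  have h1 := hval t' y' h.run'
  have h2 := h.feasible.1 w r hadj
  have h3 : min t' t₀ ≤ t₀ := min_le_right _ _
  nlinarith

end SteinerInstance

/-! ### The instance -/

namespace MoatLimit

/-- The arms of a gadget: one for each position on its spine, and one for each terminal. -/
abbrev Arm (n N : ℕ) := Fin (2 * N * n + 1) ⊕ Fin n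

/-- The vertices of the instance. For any two terminals `i` (the helper) and `j` there is a gadget.
It has a spine, which is a path that alternates between inner and outer vertices, and arms, which
are paths that alternate between valleys and peaks, ending at an inner vertex of the spine. The
case `i = j` is included for uniformity only. -/
inductive Vertex (n N : ℕ)
  | terminal (x : Fin n)
  | valley (i j : Fin n) (α : Arm n N) (m : Fin N)
  | peak (i j : Fin n) (α : Arm n N) (m : Fin N)
  | inner (i j : Fin n) (p : Fin (2 * N * n + 1))
  | outer (i j : Fin n) (p : Fin (2 * N * n + 1))
  deriving DecidableEq, Fintype

variable {n N : ℕ}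

/-- The terminal at the foot of an arm in a gadget of `j`: the arms for the positions on the spine
start at `j`, the others at their own terminals. -/
def foot (j : Fin n) : Arm n N → Fin n := Sum.elim (fun _ => j) id

/-- The position on the spine at which an arm ends. The arms of different terminals other than `j`
end at a distance of at least `4 N`, since each position accounts for two edges of cost 1. -/
def pos : Arm n N → Fin (2 * N * n + 1) :=
  Sum.elim id fun k => ⟨2 * N * k, Nat.lt_succ_of_le (Nat.mul_le_mul_left _ k.is_lt.le)⟩

/-- The cost of the last edge of an arm. The additional length of the arms of the second kind
makes the moats that use them arrive at the spine when its edges are tight already. -/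
def exitCost : Arm n N → ℝ := Sum.elim (fun _ => 1) fun _ => 5

/-- The edges, in one orientation, and their costs. Two terminals have distance `12 N`. The helper
is adjacent to all vertices of the gadget except the peaks, and its moat arrives at the `m`-th
valley of each arm at time `6 N + m`, which is two time units before that of the foot does. -/
inductive Link : Vertex n N → Vertex n N → ℝ → Prop
  | direct {x y : Fin n} (h : x ≠ y) : Link (.terminal x) (.terminal y) (12 * N)
  | toValley (i j : Fin n) (α : Arm n N) (m : Fin N) :
      Link (.terminal i) (.valley i j α m) (6 * N + (m : ℕ))
  | toFoot {x i j : Fin n} {α : Arm n N} {m : Fin N} (hx : x = foot j α) (hxi : x ≠ i)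
      (hm : (m : ℕ) = 0) : Link (.terminal x) (.valley i j α m) (6 * N + 2)
  | toInner (i j : Fin n) (p) : Link (.terminal i) (.inner i j p) (7 * N + 1)
  | toOuter (i j : Fin n) (p) : Link (.terminal i) (.outer i j p) (7 * N)
  | up (i j : Fin n) (α : Arm n N) (m : Fin N) : Link (.valley i j α m) (.peak i j α m) 2
  | down (i j : Fin n) (α : Arm n N) {m m' : Fin N} (hm : (m' : ℕ) = m + 1) :
      Link (.peak i j α m) (.valley i j α m') 1
  | exit (i j : Fin n) (α : Arm n N) {m : Fin N} {p} (hm : (m : ℕ) + 1 = N) (hp : p = pos α) :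
      Link (.peak i j α m) (.inner i j p) (exitCost α)
  | spine (i j : Fin n) (p) : Link (.inner i j p) (.outer i j p) 1
  | spine' (i j : Fin n) {p p' : Fin (2 * N * n + 1)} (hp : (p' : ℕ) = p + 1) :
      Link (.outer i j p) (.inner i j p') 1

theorem Link.unique {u v : Vertex n N} {c c' : ℝ} (h : Link u v c) (h' : Link u v c') :
    c = c' := by
  cases h <;> cases h' <;> first | rfl | contradiction

theorem Link.unique_symm {u v : Vertex n N} {c c' : ℝ} (h : Link u v c) (h' : Link v u c') :
    c = c' := by
  cases h <;> cases h' <;> first | rfl | omega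

theorem Link.cost_pos (hN : 1 ≤ N) {u v : Vertex n N} {c : ℝ} (h : Link u v c) : 0 < c := by
  have hN' : (1 : ℝ) ≤ N := by exact_mod_cast hN
  cases h
  case exit i j α m p hm hp => cases α <;> norm_num [exitCost]
  all_goals positivity

theorem Link.ne {u v : Vertex n N} {c : ℝ} (h : Link u v c) : u ≠ v := by
  rintro rfl
  cases h
  contradiction

/-- The graph of the instance. -/
def graph (n N : ℕ) : SimpleGraph (Vertex n N) where
  Adj u v := ∃ c, Link u v c ∨ Link v u c
  symm := ⟨fun _ _ ⟨c, h⟩ => ⟨c, h.symm⟩⟩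
  loopless := ⟨fun _ ⟨_, h⟩ => h.elim (fun h => h.ne rfl) fun h => h.ne rfl⟩

open Classical in
/-- The cost of an edge, and zero for pairs of vertices that are not adjacent. -/
noncomputable def cost (e : Sym2 (Vertex n N)) : ℝ :=
  if h : ∃ c u v, e = s(u, v) ∧ Link u v c then h.choose else 0

theorem Link.cost_eq {u v : Vertex n N} {c : ℝ} (h : Link u v c) : cost s(u, v) = c := by
  have hex : ∃ c u' v', s(u, v) = s(u', v') ∧ Link u' v' c := ⟨c, u, v, rfl, h⟩
  rw [cost, dif_pos hex]
  obtain ⟨u', v', he, hl⟩ := hex.choose_spec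
  rcases Sym2.eq_iff.1 he with ⟨rfl, rfl⟩ | ⟨rfl, rfl⟩
  · exact hl.unique h
  · exact hl.unique_symm h

theorem Link.cost_eq' {u v : Vertex n N} {c : ℝ} (h : Link u v c) : cost s(v, u) = c := by
  rw [Sym2.eq_swap, h.cost_eq]

theorem cost_pos (hN : 1 ≤ N) {e : Sym2 (Vertex n N)} (he : e ∈ (graph n N).edgeSet) :
    0 < cost e := by
  induction e with
  | _ u v =>
    obtain ⟨c, h | h⟩ := he
    · rw [h.cost_eq]; exact h.cost_pos hN
    · rw [h.cost_eq']; exact h.cost_pos hN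

theorem Link.adj {u v : Vertex n N} {c : ℝ} (h : Link u v c) : (graph n N).Adj u v := ⟨c, Or.inl h⟩

theorem connected_graph (hn : 1 ≤ n) : (graph n N).Connected := by
  have hterm : ∀ x y : Fin n, (graph n N).Reachable (.terminal x) (.terminal y) := by
    intro x y
    by_cases h : x = y
    · rw [h]
    · exact (Link.direct h).adj.reachable
  have h0 : ∀ v : Vertex n N, ∃ x, (graph n N).Reachable v (.terminal x) := by
    rintro (x | ⟨i, j, α, m⟩ | ⟨i, j, α, m⟩ | ⟨i, j, p⟩ | ⟨i, j, p⟩)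
    · exact ⟨x, .rfl⟩
    · exact ⟨i, (Link.toValley i j α m).adj.symm.reachable⟩
    · exact ⟨i, (Link.up i j α m).adj.symm.reachable.trans
        (Link.toValley i j α m).adj.symm.reachable⟩
    · exact ⟨i, (Link.toInner i j p).adj.symm.reachable⟩
    · exact ⟨i, (Link.toOuter i j p).adj.symm.reachable⟩
  have : Nonempty (Vertex n N) := ⟨.terminal ⟨0, hn⟩⟩
  refine ⟨fun u v => ?_⟩
  obtain ⟨x, hx⟩ := h0 u
  obtain ⟨y, hy⟩ := h0 v
  exact hx.trans ((hterm x y).trans hy.symm)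

/-- The terminals, as an embedding. -/
def terminalEmb (n N : ℕ) : Fin n ↪ Vertex n N := ⟨.terminal, fun _ _ h => by cases h; rfl⟩

/-- The instance with `n` terminals. The parameter `N` sets the scale of the long edges, compared to
which the constant costs and times become negligible. -/
noncomputable def inst (n N : ℕ) (hn : 1 ≤ n) (hN : 1 ≤ N) : SteinerInstance (Vertex n N) where
  graph := graph n N
  connected := connected_graph hn
  cost := cost
  cost_pos _ he := cost_pos hN he
  terminals := univ.map (terminalEmb n N)
  terminals_nonempty := by
    rw [Finset.map_nonempty]
    exact ⟨⟨0, hn⟩, mem_univ _⟩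

variable {hn : 1 ≤ n} {hN : 1 ≤ N}

theorem terminal_mem (x : Fin n) : Vertex.terminal x ∈ (inst n N hn hN).terminals :=
  Finset.mem_map_of_mem _ (mem_univ x)

theorem mem_terminals {v : Vertex n N} :
    v ∈ (inst n N hn hN).terminals ↔ ∃ x, v = .terminal x := by
  simp only [inst, Finset.mem_map, mem_univ, true_and, eq_comm]
  exact Iff.rfl

theorem card_terminals : #(inst n N hn hN).terminals = n := by
  simp [inst]

theorem cost_terminal {x y : Fin n} (h : x ≠ y) :
    cost (n := n) (N := N) s(.terminal x, .terminal y) = 12 * N :=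
  (Link.direct h).cost_eq

end MoatLimit

/-! ### Moat growing on the instance -/

namespace MoatLimit

open SteinerInstance

variable {n N : ℕ}

/-- Lower bound on the time at which the moat of the terminal `x` arrives at a vertex; the value
`7 N + 3` means that it does not arrive before this time. -/
def lower (x : Fin n) : Vertex n N → ℝ
  | .terminal y => if x = y then 0 else 7 * N + 3
  | .valley i j α m =>
    if x = i then 6 * N + (m : ℕ) else if x = foot j α then 6 * N + 2 + (m : ℕ) else 7 * N + 3
  | .peak i j α m => if x = i ∨ x = foot j α then 6 * N + 2 + (m : ℕ) else 7 * N + 3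
  | .inner i j _ => if x = i then 7 * N + 1 else if x = j then 7 * N + 2 else 7 * N + 3
  | .outer i _ _ => if x = i then 7 * N else 7 * N + 3

/-- Upper bound on the arrival time of the moat of the terminal `x` at a vertex: the cost of the
edge between them if `x` is the helper of the gadget, and the trivial value `7 N + 3` otherwise. -/
def upper (x : Fin n) : Vertex n N → ℝ
  | .valley i _ _ m => if x = i then 6 * N + (m : ℕ) else 7 * N + 3
  | .inner i _ _ => if x = i then 7 * N + 1 else 7 * N + 3
  | .outer i _ _ => if x = i then 7 * N else 7 * N + 3
  | _ => 7 * N + 3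

/-- A bound on the load of the directed edge `(u, v)` at time `t`, see `lower` and `upper`. -/
noncomputable def loadBound (t : ℝ) (u v : Vertex n N) : ℝ :=
  ∑ z : Fin n, max 0 (min t (upper z v) - lower z u)

/-- Only two terminals contribute to the load. -/
theorem loadBound_le {t : ℝ} {u v : Vertex n N} (i w : Fin n) {a b : ℝ} (ha : 0 ≤ a) (hb : 0 ≤ b)
    (hi : min t (upper i v) - lower i u ≤ a)
    (hw : w ≠ i → min t (upper w v) - lower w u ≤ b)
    (hz : ∀ z, z ≠ i → z ≠ w → t ≤ lower z u) : loadBound t u v ≤ a + b := by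
  have h0 : ∀ z, z ≠ i → z ≠ w → max 0 (min t (upper z v) - lower z u) = 0 := by
    intro z h1 h2
    have := hz z h1 h2
    have := min_le_left t (upper z v)
    exact max_eq_left (by linarith)
  rw [loadBound]
  by_cases hwi : w = i
  · subst hwi
    rw [Finset.sum_eq_single w (fun z _ h => h0 z h h) (by simp)]
    have := max_le ha hi
    linarith
  · rw [← Finset.sum_subset (Finset.subset_univ {i, w}), Finset.sum_pair (Ne.symm hwi)]
    · exact add_le_add (max_le ha hi) (max_le hb (hw hwi))
    · intro z _ hz'
      simp only [mem_insert, mem_singleton, not_or] at hz'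
      exact h0 z hz'.1 hz'.2

theorem loadBound_terminal {t : ℝ} {y : Fin n} {v : Vertex n N} (ht : 0 ≤ t) (ht1 : t < 7 * N + 3) :
    loadBound t (.terminal y) v ≤ t := by
  have := loadBound_le (u := .terminal y) (v := v) (t := t) y y ht le_rfl
    (by simp [lower]) (by simp) (by intro z hz _; simp [lower, hz]; linarith)
  linarith

/-- No directed edge becomes tight in time for a moat to arrive at its head before the time given by
`lower`. -/
theorem loadBound_lt {u v : Vertex n N} {c : ℝ} (hN : 2 ≤ N) (h : Link u v c ∨ Link v u c)
    {x : Fin n} {t : ℝ} (ht0 : 0 ≤ t) (ht : t < 7 * N + 3) (hu : lower x u ≤ t)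
    (hv : t < lower x v) : loadBound t u v < c := by
  have hN' : (2 : ℝ) ≤ N := by exact_mod_cast hN
  rcases h with h | h
  · cases h with
    | @direct y z _ =>
      have := loadBound_terminal (y := y) (v := .terminal z) ht0 ht
      linarith
    | toValley i j α m =>
      refine (loadBound_terminal ht0 ht).trans_lt ?_
      have : x = i := by by_contra h; simp [lower, h] at hu; linarith
      simpa [lower, this] using hv
    | @toFoot y i j α m hx hxi hm =>
      refine (loadBound_terminal ht0 ht).trans_lt ?_
      have : x = y := by by_contra h; simp [lower, h] at hu; linarith
      simpa [lower, this, hxi, hx ▸ hxi, ← hx, hm] using hv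
    | toInner i j p =>
      refine (loadBound_terminal ht0 ht).trans_lt ?_
      have : x = i := by by_contra h; simp [lower, h] at hu; linarith
      simpa [lower, this] using hv
    | toOuter i j p =>
      refine (loadBound_terminal ht0 ht).trans_lt ?_
      have : x = i := by by_contra h; simp [lower, h] at hu; linarith
      simpa [lower, this] using hv
    | up i j α m =>
      simp only [lower] at hu hv
      have h2 : t < 6 * N + 2 + (m : ℕ) := by
        split_ifs at hu <;> split_ifs at hv <;> first | linarith | tauto
      have := loadBound_le (u := .valley i j α m) (v := .peak i j α m) (t := t) i (foot j α)
        (le_max_left 0 (t - (6 * N + (m : ℕ)))) le_rfl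
        (by simp [lower, upper])
        (by intro hw; simp [lower, upper, hw]; left; linarith)
        (by intro z h1 h2; simp [lower, h1, h2]; linarith)
      refine this.trans_lt ?_
      rw [add_zero]
      exact max_lt two_pos (by linarith)
    | @down i j α m m' hm =>
      simp only [lower] at hu hv
      have hm' : ((m' : ℕ) : ℝ) = (m : ℕ) + 1 := by exact_mod_cast hm
      have h2 : t < 6 * N + 3 + (m : ℕ) := by
        split_ifs at hu <;> split_ifs at hv <;> first | linarith | tauto
      have := loadBound_le (u := .peak i j α m) (v := .valley i j α m') (t := t) i (foot j α)
        le_rfl (le_max_left 0 (t - (6 * N + 2 + (m : ℕ))))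
        (by simp [lower, upper, hm']; right; linarith)
        (by intro hw; simp [lower, upper])
        (by intro z h1 h2; simp [lower, h1, h2]; linarith)
      refine this.trans_lt ?_
      rw [zero_add]
      exact max_lt one_pos (by linarith)
    | @exit i j α m p hm hp =>
      have hm' : ((m : ℕ) : ℝ) + 1 = N := by exact_mod_cast hm
      have := loadBound_le (u := .peak i j α m) (v := .inner i j p) (t := t) i (foot j α)
        le_rfl (le_max_left 0 (t - (7 * N + 1)))
        (by simp [lower, upper]; right; linarith)
        (by intro hw; simp [lower, upper]; right; left; linarith)
        (by intro z h1 h2; simp [lower, h1, h2]; linarith)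
      refine this.trans_lt ?_
      rw [zero_add]
      simp only [lower] at hu hv
      cases α with
      | inl p =>
        simp only [foot, exitCost, Sum.elim_inl] at hu hv ⊢
        refine max_lt one_pos ?_
        rcases eq_or_ne x i with rfl | h1
        · simp only [true_or, if_true] at hu hv; linarith
        rcases eq_or_ne x j with rfl | h2
        · simp only [h1, if_true, if_false] at hv; linarith
        · simp only [h1, h2, or_self, if_false] at hu; linarith
      | inr k => exact max_lt (by norm_num [exitCost]) (by norm_num [exitCost]; linarith)
    | spine i j p =>
      simp only [lower] at hu hv
      have := loadBound_le (u := .inner i j p) (v := .outer i j p) (t := t) i j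
        le_rfl (le_max_left 0 (t - (7 * N + 2)))
        (by simp [lower, upper])
        (by intro hw; simp [lower, upper, hw])
        (by intro z h1 h2; simp [lower, h1, h2]; linarith)
      refine this.trans_lt ?_
      rw [zero_add]
      exact max_lt one_pos (by linarith)
    | @spine' i j p p' hp =>
      simp only [lower] at hu hv
      have := loadBound_le (u := .outer i j p) (v := .inner i j p') (t := t) i i
        (le_max_left 0 (t - 7 * N)) le_rfl
        (by simp [lower, upper])
        (by simp)
        (by intro z h1 h2; simp [lower, h1]; linarith)
      refine this.trans_lt ?_
      rw [add_zero]
      refine max_lt one_pos ?_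
      split_ifs at hu <;> split_ifs at hv <;> linarith
  · cases h with
    | @direct y z _ =>
      have := loadBound_terminal (y := z) (v := .terminal y) ht0 ht
      linarith
    | toValley i j α m =>
      have := loadBound_le (u := .valley i j α m) (v := .terminal i) (t := t) i (foot j α)
        (a := N + 3) (b := N + 3) (by linarith) (by linarith)
        (by simp [lower, upper]; left; linarith)
        (by intro hw; simp [lower, upper, hw]; left; linarith)
        (by intro z h1 h2; simp [lower, h1, h2]; linarith)
      have : (0 : ℝ) ≤ (m : ℕ) := Nat.cast_nonneg _
      linarith
    | @toFoot y i j α m hx hxi hm =>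
      have := loadBound_le (u := .valley i j α m) (v := .terminal y) (t := t) i (foot j α)
        (a := N + 3) (b := N + 3) (by linarith) (by linarith)
        (by simp [lower, upper]; left; linarith)
        (by intro hw; simp [lower, upper, hw]; left; linarith)
        (by intro z h1 h2; simp [lower, h1, h2]; linarith)
      linarith
    | toInner i j p =>
      have := loadBound_le (u := .inner i j p) (v := .terminal i) (t := t) i j
        (a := 2) (b := 1) two_pos.le one_pos.le
        (by simp [lower, upper]; left; linarith)
        (by intro hw; simp [lower, upper, hw]; left; linarith)
        (by intro z h1 h2; simp [lower, h1, h2]; linarith)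
      linarith
    | toOuter i j p =>
      have := loadBound_le (u := .outer i j p) (v := .terminal i) (t := t) i i
        (a := 3) (b := 0) (by norm_num) le_rfl
        (by simp [lower, upper]; left; linarith)
        (by simp)
        (by intro z h1 h2; simp [lower, h1]; linarith)
      linarith
    | up i j α m =>
      simp only [lower] at hu hv
      split_ifs at hu <;> split_ifs at hv <;> first | linarith | tauto
    | @down i j α m m' hm =>
      simp only [lower] at hu hv
      have hm' : ((m' : ℕ) : ℝ) = (m : ℕ) + 1 := by exact_mod_cast hm
      have h2 : t < 6 * N + 2 + (m : ℕ) := by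
        split_ifs at hu <;> split_ifs at hv <;> first | linarith | tauto
      have := loadBound_le (u := .valley i j α m') (v := .peak i j α m) (t := t) i (foot j α)
        (le_max_left 0 (t - (6 * N + (m' : ℕ)))) le_rfl
        (by simp [lower, upper])
        (by intro hw; simp [lower, upper, hw]; left; linarith)
        (by intro z h1 h2; simp [lower, h1, h2]; linarith)
      refine this.trans_lt ?_
      rw [add_zero]
      exact max_lt one_pos (by linarith)
    | @exit i j α m p hm hp =>
      have hm' : ((m : ℕ) : ℝ) + 1 = N := by exact_mod_cast hm
      cases α with
      | inl q =>
        simp only [lower, foot, Sum.elim_inl] at hu hv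
        rcases eq_or_ne x i with rfl | h1
        · simp only [true_or, if_true] at hu hv; linarith
        rcases eq_or_ne x j with rfl | h2
        · simp only [h1, or_true, if_true, if_false] at hu hv; linarith
        · simp only [h1, h2, if_false] at hu; linarith
      | inr k =>
        have := loadBound_le (u := .inner i j p) (v := .peak i j (.inr k) m) (t := t) i j
          (a := 2) (b := 1) two_pos.le one_pos.le
          (by simp [lower, upper]; left; linarith)
          (by intro hw; simp [lower, upper, hw]; left; linarith)
          (by intro z h1 h2; simp [lower, h1, h2]; linarith)
        norm_num [exitCost]
        linarith
    | spine i j p =>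
      simp only [lower] at hu hv
      have := loadBound_le (u := .outer i j p) (v := .inner i j p) (t := t) i i
        (le_max_left 0 (t - 7 * N)) le_rfl
        (by simp [lower, upper])
        (by simp)
        (by intro z h1 h2; simp [lower, h1]; linarith)
      refine this.trans_lt ?_
      rw [add_zero]
      refine max_lt one_pos ?_
      split_ifs at hu <;> split_ifs at hv <;> linarith
    | @spine' i j p p' hp =>
      simp only [lower] at hu hv
      have := loadBound_le (u := .inner i j p') (v := .outer i j p) (t := t) i j
        le_rfl (le_max_left 0 (t - (7 * N + 2)))
        (by simp [lower, upper])
        (by intro hw; simp [lower, upper, hw])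
        (by intro z h1 h2; simp [lower, h1, h2]; linarith)
      refine this.trans_lt ?_
      rw [zero_add]
      exact max_lt one_pos (by linarith)

variable {hn : 1 ≤ n} {hN : 1 ≤ N} {M : MergePlan (inst n N hn hN).terminals}

theorem Link.arrivesBy {u v : Vertex n N} {c : ℝ} (h : Link u v c ∨ Link v u c) {x : Fin n} {σ : ℝ}
    (hσ : 0 ≤ σ) (ha : (inst n N hn hN).ArrivesBy M (.terminal x) u σ) :
    (inst n N hn hN).ArrivesBy M (.terminal x) v (σ + c) := by
  have hc : (inst n N hn hN).cost s(u, v) = c := h.elim Link.cost_eq Link.cost_eq'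
  rw [← hc]
  exact ha.adj (terminal_mem x) hσ ⟨c, h⟩

theorem Link.tight {u v : Vertex n N} {c : ℝ} (h : Link u v c ∨ Link v u c) {x : Fin n} {σ : ℝ}
    (hσ : 0 ≤ σ) (ha : (inst n N hn hN).ArrivesBy M (.terminal x) u σ)
    (hv : ∀ t y, (inst n N hn hN).Run M t y → t < σ + c →
      ¬ (inst n N hn hN).Covers M t y (.terminal x) v)
    {t : ℝ} {y : Finset (Vertex n N) → ℝ} (hr : (inst n N hn hN).Run M t y) (ht : σ + c ≤ t) :
    (inst n N hn hN).Tight y u v := by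
  have hc : (inst n N hn hN).cost s(u, v) = c := h.elim Link.cost_eq Link.cost_eq'
  rw [← hc] at hv ht
  exact ha.tight (terminal_mem x) hσ ⟨c, h⟩ hv hr ht

theorem arrivesBy_upper {x : Fin n} {v : Vertex n N} (h : upper x v < 7 * N + 3) :
    (inst n N hn hN).ArrivesBy M (.terminal x) v (upper x v) := by
  have h0 := arrivesBy_self (M := M) (σ := 0) (terminal_mem (hn := hn) (hN := hN) x)
  rw [← zero_add (upper x v)]
  cases v with
  | terminal => simp [upper] at h
  | peak => simp [upper] at h
  | valley i j α m =>
    have hx : x = i := by by_contra hx; simp [upper, hx] at h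
    subst hx
    simpa [upper] using Link.arrivesBy (Or.inl (Link.toValley x j α m)) le_rfl h0
  | inner i j p =>
    have hx : x = i := by by_contra hx; simp [upper, hx] at h
    subst hx
    simpa [upper] using Link.arrivesBy (Or.inl (Link.toInner x j p)) le_rfl h0
  | outer i j p =>
    have hx : x = i := by by_contra hx; simp [upper, hx] at h
    subst hx
    simpa [upper] using Link.arrivesBy (Or.inl (Link.toOuter x j p)) le_rfl h0

/-- The lower bounds on the arrival times are correct. -/
theorem lower_le (hN2 : 2 ≤ N) {t : ℝ} {y : Finset (Vertex n N) → ℝ}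
    (hr : (inst n N hn hN).Run M t y) (ht : t < 7 * N + 3) {x : Fin n} {v : Vertex n N}
    (hv : Relation.ReflTransGen ((inst n N hn hN).Tight y) (.terminal x) v) : lower x v ≤ t := by
  let a (f : Fin n → Vertex n N → ℝ) (z v : Vertex n N) : ℝ :=
    match z with
    | .terminal x => f x v
    | _ => 0
  refine le_of_reflTransGen_tight (M := M) (a := a lower) (τ := a upper) (t₁ := 7 * N + 3)
    ?_ ?_ ?_ hr ht (terminal_mem x) hv
  · intro z hz v h
    obtain ⟨z, rfl⟩ := mem_terminals.1 hz
    exact arrivesBy_upper h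
  · intro z hz
    obtain ⟨z, rfl⟩ := mem_terminals.1 hz
    simp [a, lower]
  · intro u v huv z hz t h0 ht1 h1 h2
    obtain ⟨z, rfl⟩ := mem_terminals.1 hz
    obtain ⟨c, hc⟩ := huv
    have hcost : (inst n N hn hN).cost s(u, v) = c := hc.elim Link.cost_eq Link.cost_eq'
    rw [hcost]
    have := loadBound_lt hN2 hc h0 ht1 h1 h2
    change ∑ z ∈ univ.map (terminalEmb n N), _ < _
    rw [Finset.sum_map]
    exact this

theorem not_covers (hN2 : 2 ≤ N) {t : ℝ} {y : Finset (Vertex n N) → ℝ}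
    (hr : (inst n N hn hN).Run M t y) (ht : t < 7 * N + 3) {x : Fin n} {v : Vertex n N}
    (hv : ∀ z : Fin n, Merged M t (.terminal x) (.terminal z) → t < lower z v) :
    ¬ (inst n N hn hN).Covers M t y (.terminal x) v := by
  rintro ⟨z, hz, hm, hzv⟩
  obtain ⟨z, rfl⟩ := mem_terminals.1 hz
  exact absurd (lower_le hN2 hr ht hzv) (not_le.2 (hv z hm))

/-- The helper makes the edges from the valleys to the peaks tight. -/
theorem tight_up (hN2 : 2 ≤ N) (i j : Fin n) (α : Arm n N) (m : Fin N) {t : ℝ}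
    {y : Finset (Vertex n N) → ℝ} (hr : (inst n N hn hN).Run M t y)
    (ht : 6 * N + 2 + (m : ℕ) ≤ t) :
    (inst n N hn hN).Tight y (.valley i j α m) (.peak i j α m) := by
  have hm : ((m : ℕ) : ℝ) + 1 ≤ N := by exact_mod_cast m.is_lt
  have ha := arrivesBy_upper (M := M) (x := i) (v := .valley i j α m)
    (by simp only [upper, if_true]; linarith)
  simp only [upper, if_true] at ha
  refine Link.tight (Or.inl (Link.up i j α m)) (by positivity) ha (fun t y hr ht => ?_) hr
    (by linarith)
  refine not_covers hN2 hr (by linarith) fun z _ => ?_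
  simp only [lower]
  split_ifs <;> linarith

/-- The moat of the foot of an arm moves along the arm at three times the unit speed: the edges to
the peaks are tight when it reaches them. -/
theorem arrivesBy_valley (hN2 : 2 ≤ N) (i j : Fin n) (α : Arm n N) (m : ℕ) (hm : m < N) :
    (inst n N hn hN).ArrivesBy M (.terminal (foot j α)) (.valley i j α ⟨m, hm⟩)
      (6 * N + 2 + m) := by
  have h0 := arrivesBy_self (M := M) (σ := 0)
    (terminal_mem (hn := hn) (hN := hN) (foot j α))
  induction m with
  | zero =>
    by_cases h : foot j α = i
    · have := Link.arrivesBy (Or.inl (Link.toValley (foot j α) j α ⟨0, hm⟩)) le_rfl h0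
      rw [h] at this ⊢
      exact this.mono (by simp)
    · simpa using Link.arrivesBy
        (Or.inl (Link.toFoot (α := α) (m := ⟨0, hm⟩) rfl h rfl)) le_rfl h0
  | succ m ih =>
    have h1 := (ih (by omega)).of_tight fun t y hr ht =>
      tight_up hN2 i j α ⟨m, by omega⟩ hr ht
    have := Link.arrivesBy (Or.inl (Link.down i j α (m' := ⟨m + 1, hm⟩) rfl)) (by positivity) h1
    refine this.mono (le_of_eq ?_)
    push_cast
    ring

/-- The moat of `j` arrives at all inner vertices of its gadgets by time `7 N + 2`, and the moat of
any terminal arrives at the end of its own arm by time `7 N + 6`. -/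
theorem arrivesBy_inner (hN2 : 2 ≤ N) (i j : Fin n) (α : Arm n N) :
    (inst n N hn hN).ArrivesBy M (.terminal (foot j α)) (.inner i j (pos α))
      (7 * N + 1 + exitCost α) := by
  have h1 := (arrivesBy_valley (M := M) hN2 i j α (N - 1) (by omega)).of_tight fun t y hr ht =>
      tight_up hN2 i j α ⟨N - 1, by omega⟩ hr ht
  have := Link.arrivesBy (Or.inl (Link.exit i j α (by simp; omega) rfl)) (by positivity) h1
  refine this.mono (le_of_eq ?_)
  rw [Nat.cast_sub hN]
  push_cast
  ring

/-- The helper makes the edges from the outer to the inner vertices tight. -/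
theorem tight_outer_inner (hN2 : 2 ≤ N) (i j : Fin n) {p p' : Fin (2 * N * n + 1)}
    (hp : (p' : ℕ) = p + 1) {t : ℝ} {y : Finset (Vertex n N) → ℝ}
    (hr : (inst n N hn hN).Run M t y) (ht : 7 * N + 1 ≤ t) :
    (inst n N hn hN).Tight y (.outer i j p) (.inner i j p') := by
  have ha := arrivesBy_upper (M := M) (x := i) (v := .outer i j p)
    (by simp only [upper, if_true]; linarith)
  simp only [upper, if_true] at ha
  refine Link.tight (Or.inl (Link.spine' i j hp)) (by positivity) ha (fun t y hr ht => ?_) hr ht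
  refine not_covers hN2 hr (by linarith) fun z _ => ?_
  simp only [lower]
  split_ifs <;> linarith

/-- The moat of `j` makes the edges from the inner to the outer vertices tight, unless it is merged
with the moat of the helper. -/
theorem tight_inner_outer (hN2 : 2 ≤ N) {i j : Fin n}
    (hij : ∀ t < (7 * N + 3 : ℝ), ¬ Merged M t (.terminal j) (.terminal i))
    (p : Fin (2 * N * n + 1)) {t : ℝ} {y : Finset (Vertex n N) → ℝ}
    (hr : (inst n N hn hN).Run M t y) (ht : 7 * N + 3 ≤ t) :
    (inst n N hn hN).Tight y (.inner i j p) (.outer i j p) := by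
  have ha : (inst n N hn hN).ArrivesBy M (.terminal j) (.inner i j p) (7 * N + 1 + 1) :=
    arrivesBy_inner hN2 i j (.inl p)
  refine Link.tight (Or.inl (Link.spine i j p)) (by positivity) ha (fun t y hr ht => ?_) hr
    (by linarith)
  refine not_covers hN2 hr (by linarith) fun z hz => ?_
  have hzi : z ≠ i := by
    rintro rfl
    exact hij t (by linarith) hz
  simp only [lower, hzi, if_false]
  linarith

/-- If `j` is not merged with the helper too soon, then all moats arrive at the last vertex of the
spine. -/
theorem arrivesBy_last (hN2 : 2 ≤ N) {i j : Fin n}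
    (hij : ∀ t < (7 * N + 3 : ℝ), ¬ Merged M t (.terminal j) (.terminal i)) (k : Fin n) :
    (inst n N hn hN).ArrivesBy M (.terminal k) (.outer i j (Fin.last _)) (7 * N + 6) := by
  have hstart : (inst n N hn hN).ArrivesBy M (.terminal k) (.inner i j (pos (.inr k)))
      (7 * N + 1 + 5) := arrivesBy_inner hN2 i j (.inr k)
  have key : ∀ q : ℕ, ∀ hq : q < 2 * N * n + 1, 2 * N * k ≤ q →
      (inst n N hn hN).ArrivesBy M (.terminal k) (.outer i j ⟨q, hq⟩) (7 * N + 6) := by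
    intro q hq hkq
    induction q, hkq using Nat.le_induction with
    | base =>
      refine (hstart.mono (by linarith)).of_tight fun t y hr ht => ?_
      exact tight_inner_outer hN2 hij _ hr (by linarith)
    | succ q hkq ih =>
      have h1 := (ih (by omega)).of_tight fun t y hr ht =>
        tight_outer_inner hN2 i j (p' := ⟨q + 1, hq⟩) rfl hr (by linarith)
      exact h1.of_tight fun t y hr ht => tight_inner_outer hN2 hij _ hr (by linarith)
  exact key _ _ (Nat.mul_le_mul_left _ k.is_lt.le)

/-- All merge plans yield dual solutions of value about `7 N` per terminal: the gadget whose helper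
is the root provides a vertex at distance `7 N` from the root to which all moats come soon. -/
theorem dualValue_le (hN2 : 2 ≤ N) {t : ℝ} {y : Finset (Vertex n N) → ℝ}
    (h : (inst n N hn hN).Run M t y) {r : Vertex n N} (hr : r ∈ (inst n N hn hN).terminals) :
    (inst n N hn hN).dualValue r y ≤ (n - 1) * (7 * N + 6) + 7 * N := by
  have := h.dualValue_le_of_arrivesBy hr (t₀ := 7 * N + 6) (c := 7 * N) (by positivity)
    (by positivity) fun j hj hm => ?_
  · rwa [card_terminals] at this
  obtain ⟨i, rfl⟩ := mem_terminals.1 hr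
  obtain ⟨j, rfl⟩ := mem_terminals.1 hj
  refine ⟨.outer i j (Fin.last _), (Link.toOuter i j _).adj.symm,
    (Link.toOuter i j _).cost_eq'.le, fun k hk => ?_⟩
  obtain ⟨k, rfl⟩ := mem_terminals.1 hk
  exact arrivesBy_last hN2 (fun t ht => hm t (by linarith)) k

end MoatLimit

/-! ### Terminal spanning trees -/

namespace MoatLimit

open SteinerInstance

variable {n N : ℕ}

/-- A function on the vertices changes along a walk at most by the total of the bounds on its
changes along the edges. -/
theorem abs_sub_le_sum_edges {V : Type*} {G : SimpleGraph V} {f : V → ℝ} {g : Sym2 V → ℝ}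
    (h : ∀ u v, G.Adj u v → |f u - f v| ≤ g s(u, v)) {u v : V} (p : G.Walk u v) :
    |f u - f v| ≤ (p.edges.map g).sum := by
  induction p with
  | nil => simp
  | @cons u w v huw p ih =>
    rw [SimpleGraph.Walk.edges_cons, List.map_cons, List.sum_cons]
    exact (abs_sub_le _ (f w) _).trans (add_le_add (h _ _ huw) ih)

variable {hn : 1 ≤ n} {hN : 1 ≤ N}

/-- The terminals have pairwise distance `12 N`, since all edges between terminals and other
vertices cost at least `6 N`. -/
theorem dist_terminal {x y : Fin n} (hxy : x ≠ y) :
    (inst n N hn hN).dist (.terminal x) (.terminal y) = 12 * N := by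
  have hbdd : ∀ p : (graph n N).Walk (.terminal x) (.terminal y),
      12 * (N : ℝ) ≤ (p.edges.map cost).sum := by
    intro p
    let f : Vertex n N → ℝ := fun v =>
      match v with
      | .terminal z => if z = x then -(6 * N) else 6 * N
      | _ => 0
    have hf : ∀ u v c, Link u v c → |f u - f v| ≤ c := by
      intro u v c h
      have hN0 : (0 : ℝ) ≤ N := Nat.cast_nonneg _
      cases h with
      | direct h => simp only [f]; split_ifs <;> rw [abs_le] <;> constructor <;> linarith
      | toValley i j α m =>
        have : (0 : ℝ) ≤ (m : ℕ) := Nat.cast_nonneg _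
        simp only [f]; split_ifs <;> rw [abs_le] <;> constructor <;> linarith
      | exit i j α => cases α <;> simp [f, exitCost]
      | _ => (simp only [f]; try split_ifs) <;> rw [abs_le] <;> constructor <;> linarith
    have := abs_sub_le_sum_edges (G := graph n N) (f := f) (g := cost) (fun u v ⟨c, h⟩ => by
      rcases h with h | h
      · rw [h.cost_eq]; exact hf _ _ _ h
      · rw [h.cost_eq', abs_sub_comm]; exact hf _ _ _ h) p
    refine le_trans ?_ this
    simp only [f, if_true, hxy.symm, if_false]
    refine le_trans ?_ (neg_le_abs _)
    linarith
  refine le_antisymm ?_ ?_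
  · have : (graph n N).Adj (.terminal x) (.terminal y) := (Link.direct hxy).adj
    rw [SteinerInstance.dist]
    refine (ciInf_le (f := fun p : (graph n N).Walk (.terminal x) (.terminal y) =>
      (p.edges.map cost).sum) ⟨12 * N, ?_⟩ this.toWalk).trans ?_
    · rintro _ ⟨p, rfl⟩
      exact hbdd p
    · simp [cost_terminal hxy]
  · have : Nonempty ((inst n N hn hN).graph.Walk (.terminal x) (.terminal y)) :=
      ⟨(Link.direct hxy).adj.toWalk⟩
    exact le_ciInf hbdd

theorem terminalGraphCost_eq {T : SimpleGraph (inst n N hn hN).terminals} (hT : T.IsTree) :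
    (inst n N hn hN).terminalGraphCost T = 12 * N * (n - 1) := by
  classical
  have h1 : ∀ e ∈ ({e | e ∈ T.edgeSet} : Finset (Sym2 _)),
      (inst n N hn hN).closureCost e = 12 * N := by
    intro e he
    induction e with
    | _ u v =>
      obtain ⟨u, hu⟩ := u
      obtain ⟨v, hv⟩ := v
      obtain ⟨x, rfl⟩ := mem_terminals.1 hu
      obtain ⟨y, rfl⟩ := mem_terminals.1 hv
      simp only [mem_filter, mem_univ, true_and, SimpleGraph.mem_edgeSet] at he
      refine dist_terminal ?_
      rintro rfl
      exact T.loopless.irrefl _ he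
  have h2 := hT.card_edgeFinset
  rw [Fintype.card_coe, card_terminals] at h2
  have h3 : ({e | e ∈ T.edgeSet} : Finset (Sym2 _)) = T.edgeFinset := by ext; simp
  have h4 : ((#T.edgeFinset : ℕ) : ℝ) + 1 = n := by exact_mod_cast h2
  rw [terminalGraphCost, Finset.sum_congr rfl h1, Finset.sum_const, h3, nsmul_eq_mul]
  rw [← h4]
  ring

theorem TMST_eq : (inst n N hn hN).TMST = 12 * N * (n - 1) := by
  have : Nonempty (inst n N hn hN).terminals :=
    (inst n N hn hN).terminals_nonempty.coe_sort
  obtain ⟨T, -, hT⟩ :=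
    (SimpleGraph.connected_top (V := (inst n N hn hN).terminals)).exists_isTree_le
  have : {a : ℝ | ∃ T : SimpleGraph (inst n N hn hN).terminals, T.IsTree ∧
      (inst n N hn hN).terminalGraphCost T = a} = {(12 * N * (n - 1) : ℝ)} := by
    ext a
    constructor
    · rintro ⟨T, hT, rfl⟩
      exact terminalGraphCost_eq hT
    · rintro rfl
      exact ⟨T, hT, terminalGraphCost_eq hT⟩
  rw [TMST, this, csInf_singleton]

end MoatLimit

/-! ### Steiner trees -/

namespace MoatLimit

open SteinerInstance

variable {n N : ℕ}

/-- The gadget to which a vertex belongs, if it is not a terminal. -/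
def gadget : Vertex n N → Option (Fin n × Fin n)
  | .terminal _ => none
  | .valley i j _ _ => some (i, j)
  | .peak i j _ _ => some (i, j)
  | .inner i j _ => some (i, j)
  | .outer i j _ => some (i, j)

/-- The arm to which a vertex belongs, if it is not on a spine. -/
def arm : Vertex n N → Option (Arm n N)
  | .valley _ _ α _ => some α
  | .peak _ _ α _ => some α
  | _ => none

/-- The distance along the arm from its first valley. -/
def armPos : Vertex n N → ℝ
  | .valley _ _ _ m => 3 * (m : ℕ)
  | .peak _ _ _ m => 3 * (m : ℕ) + 2
  | _ => 0

/-- The position along the spine. -/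
def spinePos : Vertex n N → ℝ
  | .valley _ _ α _ => 2 * (pos α : ℕ)
  | .peak _ _ α _ => 2 * (pos α : ℕ)
  | .inner _ _ p => 2 * (p : ℕ)
  | .outer _ _ p => 2 * (p : ℕ) + 1
  | _ => 0

theorem Link.gadget_eq {u v : Vertex n N} {c : ℝ} (h : Link u v c) (hu : gadget u ≠ none) :
    gadget v = gadget u := by
  cases h <;> first | rfl | exact absurd rfl hu

theorem gadget_eq_of_adj {u v : Vertex n N} (h : (graph n N).Adj u v) (hu : gadget u ≠ none)
    (hv : gadget v ≠ none) : gadget u = gadget v := by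
  obtain ⟨c, h | h⟩ := h
  · exact (h.gadget_eq hu).symm
  · exact h.gadget_eq hv

/-- The classes into which the edges of a gadget are divided: the edges at each terminal, the edges
of each arm, and the edges of the spine. -/
def InClass : Fin n ⊕ Arm n N ⊕ Unit → Sym2 (Vertex n N) → Prop
  | .inl x, e => .terminal x ∈ e
  | .inr (.inl α), e => (∀ v ∈ e, gadget v ≠ none) ∧ ∃ v ∈ e, arm v = some α
  | .inr (.inr _), e => (∀ v ∈ e, gadget v ≠ none) ∧ ∀ v ∈ e, arm v = none

theorem arm_eq_of_adj {u v : Vertex n N} (h : (graph n N).Adj u v) {α β : Arm n N}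
    (hu : arm u = some α) (hv : arm v = some β) : α = β := by
  obtain ⟨c, h | h⟩ := h <;> cases h <;> simp_all [arm]

theorem InClass.unique {e : Sym2 (Vertex n N)} (he : e ∈ (graph n N).edgeSet)
    (he' : ∃ v ∈ e, gadget v ≠ none) {k l : Fin n ⊕ Arm n N ⊕ Unit} (hk : InClass k e)
    (hl : InClass l e) : k = l := by
  induction e with
  | _ u v =>
    rcases k with x | α | ⟨⟩ <;> rcases l with y | β | ⟨⟩
    · simp only [InClass, Sym2.mem_iff] at hk hl he'
      obtain ⟨w, hw, hw'⟩ := he'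
      rcases hk with rfl | rfl <;> rcases hl with hl | hl <;> rcases hw with rfl | rfl <;>
        first
        | exact absurd rfl hw'
        | (cases hl; first | rfl | exact absurd rfl hw')
    · exact absurd rfl (hl.1 _ hk)
    · exact absurd rfl (hl.1 _ hk)
    · exact absurd rfl (hk.1 _ hl)
    · obtain ⟨-, a, ha, haα⟩ := hk
      obtain ⟨-, b, hb, hbβ⟩ := hl
      have : α = β := by
        rcases Sym2.mem_iff.1 ha with rfl | rfl <;> rcases Sym2.mem_iff.1 hb with rfl | rfl
        · exact Option.some.inj (haα.symm.trans hbβ)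
        · exact arm_eq_of_adj he haα hbβ
        · exact arm_eq_of_adj he.symm haα hbβ
        · exact Option.some.inj (haα.symm.trans hbβ)
      rw [this]
    · obtain ⟨-, a, ha, haα⟩ := hk
      have := hl.2 a ha
      rw [haα] at this
      cases this
    · exact absurd rfl (hk.1 _ hl)
    · obtain ⟨-, a, ha, haα⟩ := hl
      have := hk.2 a ha
      rw [haα] at this
      cases this
    · rfl

open Classical in
/-- The distance along the arm `α`, extended by the constant `3 N` off this arm, changes at most by
the costs of the edges of the arm. -/
theorem Link.abs_armPos_sub_le (α : Arm n N) {u v : Vertex n N} {c : ℝ} (h : Link u v c)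
    (hu : gadget u ≠ none) :
    |(if arm u = some α then armPos u else 3 * N) - (if arm v = some α then armPos v else 3 * N)| ≤
      if InClass (.inr (.inl α)) s(u, v) then c else 0 := by
  cases h with
  | up i j β m =>
    by_cases hβ : β = α
    · simp [arm, hβ, InClass, gadget, armPos]
    · simp [arm, hβ, InClass, gadget]
  | @down i j β m m' hm =>
    have hm' : ((m' : ℕ) : ℝ) = (m : ℕ) + 1 := by exact_mod_cast hm
    by_cases hβ : β = α
    · simp [arm, hβ, InClass, gadget, armPos, hm']
      rw [abs_le]; constructor <;> linarith
    · simp [arm, hβ, InClass, gadget]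
  | @exit i j β m p hm hp =>
    have hm' : ((m : ℕ) : ℝ) + 1 = N := by exact_mod_cast hm
    by_cases hβ : β = α
    · subst hβ
      have : 1 ≤ exitCost β := by cases β <;> norm_num [exitCost]
      simp [arm, InClass, gadget, armPos]
      rw [abs_le]; constructor <;> linarith
    · simp [arm, hβ, InClass, gadget]
  | spine => simp [arm, InClass, gadget]
  | spine' => simp [arm, InClass, gadget]
  | _ => exact absurd rfl hu

open Classical in
theorem Link.abs_spinePos_sub_le {u v : Vertex n N} {c : ℝ} (h : Link u v c)
    (hu : gadget u ≠ none) :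
    |spinePos u - spinePos v| ≤ if InClass (.inr (.inr ())) s(u, v) then c else 0 := by
  cases h with
  | up i j β m => simp [arm, InClass, gadget, spinePos]
  | @down i j β m m' hm => simp [arm, InClass, gadget, spinePos]
  | @exit i j β m p hm hp => simp [arm, InClass, gadget, spinePos, hp]
  | spine => simp [arm, InClass, gadget, spinePos]
  | @spine' i j p p' hp =>
    have hp' : ((p' : ℕ) : ℝ) = (p : ℕ) + 1 := by exact_mod_cast hp
    simp [arm, InClass, gadget, spinePos, hp']
    rw [abs_le]; constructor <;> linarith
  | _ => exact absurd rfl hu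

/-- The edges between the terminals and a gadget cost at least `6 N`, and a terminal other than the
helper is adjacent to first valleys only. -/
theorem cost_attach {i j x : Fin n} {v : Vertex n N} (h : (graph n N).Adj (.terminal x) v)
    (hv : gadget v = some (i, j)) : 6 * N ≤ cost s(.terminal x, v) ∧
      (x = i ∨ ∃ α, ∃ m : Fin N, (m : ℕ) = 0 ∧ v = .valley i j α m ∧ foot j α = x) := by
  obtain ⟨c, h | h⟩ := h
  · rw [h.cost_eq]
    cases h with
    | direct => cases hv
    | toValley _ _ α m =>
      cases hv
      exact ⟨by simp, Or.inl rfl⟩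
    | @toFoot _ _ _ α m hx _ hm =>
      cases hv
      exact ⟨by simp, Or.inr ⟨α, m, hm, rfl, hx.symm⟩⟩
    | toInner =>
      cases hv
      exact ⟨by have : (0 : ℝ) ≤ N := Nat.cast_nonneg _; linarith, Or.inl rfl⟩
    | toOuter =>
      cases hv
      exact ⟨by have : (0 : ℝ) ≤ N := Nat.cast_nonneg _; linarith, Or.inl rfl⟩
  · cases h
    cases hv

/-- The part of a subgraph that avoids the terminals. -/
def steinerPart (T : (graph n N).Subgraph) : SimpleGraph (Vertex n N) where
  Adj u v := T.Adj u v ∧ gadget u ≠ none ∧ gadget v ≠ none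
  symm := ⟨fun _ _ h => ⟨h.1.symm, h.2.2, h.2.1⟩⟩
  loopless := ⟨fun _ h => h.1.ne rfl⟩

open Classical in
/-- The edges of a subgraph with an endpoint in the given component of its part that avoids the
terminals. -/
noncomputable def compEdges (T : (graph n N).Subgraph) (v₀ : Vertex n N) :
    Finset (Sym2 (Vertex n N)) :=
  {e | e ∈ T.edgeSet ∧ ∃ v ∈ e, gadget v ≠ none ∧ (steinerPart T).Reachable v₀ v}

open Classical in
/-- The terminals to which this component is connected. -/
noncomputable def compTerminals (T : (graph n N).Subgraph) (v₀ : Vertex n N) : Finset (Fin n) :=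
  {x | ∃ v, gadget v ≠ none ∧ (steinerPart T).Reachable v₀ v ∧ T.Adj (.terminal x) v}

variable {T : (graph n N).Subgraph} {v₀ : Vertex n N}

theorem gadget_of_reachable {i j : Fin n} (h0 : gadget v₀ = some (i, j)) {v : Vertex n N}
    (h : (steinerPart T).Reachable v₀ v) : gadget v = some (i, j) := by
  rw [SimpleGraph.reachable_iff_reflTransGen] at h
  induction h with
  | refl => exact h0
  | tail _ h ih => rw [← ih, gadget_eq_of_adj h.1.adj_sub h.2.1 h.2.2]

open Classical in
/-- If a function changes along the edges of a class at most by their costs, and not at all along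
the other edges, then the edges of this class in a connected set of vertices cost at least as much
as this function varies on the set. -/
theorem abs_sub_le_sum_class (hN : 1 ≤ N) {P : Sym2 (Vertex n N) → Prop} {f : Vertex n N → ℝ}
    (hf : ∀ u v c, Link u v c → gadget u ≠ none →
      |f u - f v| ≤ if P s(u, v) then c else 0)
    {u w : Vertex n N}
    (hu : (steinerPart T).Reachable v₀ u) (hw : (steinerPart T).Reachable v₀ w) :
    |f u - f w| ≤ ∑ e ∈ compEdges T v₀ with P e, cost e := by
  obtain ⟨p⟩ := hu.symm.trans hw
  have hpath := p.bypass_isPath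
  set q := p.bypass
  have h1 := abs_sub_le_sum_edges (G := steinerPart T) (f := f)
    (g := fun e => if P e then cost e else 0) (fun u v h => by
      obtain ⟨c, hc | hc⟩ := h.1.adj_sub
      · rw [hc.cost_eq]; exact hf u v c hc h.2.1
      · rw [hc.cost_eq', abs_sub_comm, Sym2.eq_swap]; exact hf v u c hc h.2.2) q
  refine h1.trans ?_
  rw [Finset.sum_filter, ← List.sum_toFinset _ hpath.edges_nodup]
  refine Finset.sum_le_sum_of_subset_of_nonneg ?_ ?_
  · intro e he
    rw [List.mem_toFinset] at he
    have he' := q.edges_subset_edgeSet he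
    induction e with
    | _ a b =>
      rw [compEdges, mem_filter]
      refine ⟨mem_univ _, he'.1, a, Sym2.mem_mk_left _ _, he'.2.1, ?_⟩
      exact hu.trans (q.takeUntil a (q.fst_mem_support_of_mem_edges he)).reachable
  · intro e he _
    have : e ∈ T.edgeSet := (mem_filter.1 he).2.1
    have := cost_pos hN (T.edgeSet_subset this)
    split_ifs <;> linarith

open Classical in
theorem sum_classes_le (hN : 1 ≤ N) (L : Finset (Fin n ⊕ Arm n N ⊕ Unit)) :
    ∑ k ∈ L, ∑ e ∈ compEdges T v₀ with InClass k e, cost e ≤ ∑ e ∈ compEdges T v₀, cost e := by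
  rw [← Finset.sum_biUnion]
  · refine Finset.sum_le_sum_of_subset_of_nonneg ?_ fun e he _ => ?_
    · exact Finset.biUnion_subset.2 fun _ _ => Finset.filter_subset _ _
    · exact (cost_pos hN (T.edgeSet_subset (mem_filter.1 he).2.1)).le
  · intro k _ l _ hkl
    refine Finset.disjoint_left.2 fun e he he' => hkl ?_
    obtain ⟨he, hk⟩ := mem_filter.1 he
    obtain ⟨-, hT, v, hv, hv', -⟩ := mem_filter.1 he
    exact InClass.unique (T.edgeSet_subset hT) ⟨v, hv, hv'⟩ hk (mem_filter.1 he').2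

theorem mem_compTerminals {x : Fin n} : x ∈ compTerminals T v₀ ↔
    ∃ v, gadget v ≠ none ∧ (steinerPart T).Reachable v₀ v ∧ T.Adj (.terminal x) v := by
  simp [compTerminals]

open Classical in
theorem sum_inl_ge (hN : 1 ≤ N) {i j : Fin n} (h0 : gadget v₀ = some (i, j)) {x : Fin n}
    (hx : x ∈ compTerminals T v₀) :
    6 * N ≤ ∑ e ∈ compEdges T v₀ with InClass (.inl x) e, cost e := by
  obtain ⟨v, hv, hr, hadj⟩ := mem_compTerminals.1 hx
  refine (cost_attach hadj.adj_sub (gadget_of_reachable h0 hr)).1.trans ?_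
  refine Finset.single_le_sum (f := cost) (fun e he => ?_) ?_
  · exact (cost_pos hN (T.edgeSet_subset (mem_filter.1 (mem_filter.1 he).1).2.1)).le
  · rw [mem_filter, compEdges, mem_filter]
    exact ⟨⟨mem_univ _, hadj, v, Sym2.mem_mk_right _ _, hv, hr⟩, Sym2.mem_mk_left _ _⟩

/-- A connected set of vertices of a gadget, together with its edges to a set `X` of terminals,
costs at least as much as `#X - 1` direct edges between terminals. Each edge to a terminal costs at
least `6 N`. Unless the set is contained in an arm, it contains for each terminal other than the
helper an entire arm of length `3 N`. The arms of the terminals other than `i` and `j` end at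
different positions of the spine, and any two of these have distance at least `4 N`. -/
theorem comp_cost_ge (hN : 1 ≤ N) {i j : Fin n} (h0 : gadget v₀ = some (i, j)) :
    12 * N * (#(compTerminals T v₀) : ℝ) ≤ ∑ e ∈ compEdges T v₀, cost e + 12 * N := by
  classical
  set X := compTerminals T v₀ with hX
  have hN' : (1 : ℝ) ≤ N := by exact_mod_cast hN
  have hattach : ∀ x ∈ X, x = i ∨ ∃ α m, (m : Fin N).val = 0 ∧ foot j α = x ∧
      (steinerPart T).Reachable v₀ (.valley i j α m) := by
    intro x hx
    obtain ⟨v, hv, hr, hadj⟩ := mem_compTerminals.1 hx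
    rcases (cost_attach hadj.adj_sub (gadget_of_reachable h0 hr)).2 with h | ⟨α, m, hm, rfl, h⟩
    · exact Or.inl h
    · exact Or.inr ⟨α, m, hm, h, hr⟩
  have hinl : 6 * N * (#X : ℝ) ≤ ∑ x ∈ X, ∑ e ∈ compEdges T v₀ with InClass (.inl x) e, cost e := by
    rw [mul_comm, ← nsmul_eq_mul]
    exact Finset.card_nsmul_le_sum _ _ _ fun x hx => sum_inl_ge hN h0 hx
  have hle2 : (#X : ℝ) ≤ 2 → 12 * N * (#X : ℝ) ≤ ∑ e ∈ compEdges T v₀, cost e + 12 * N := by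
    intro h2
    have h3 := sum_classes_le (T := T) (v₀ := v₀) hN (X.map .inl)
    rw [Finset.sum_map] at h3
    have := hinl.trans h3
    nlinarith
  have hexα : ∀ x ∈ X.erase i, ∃ α : Arm n N, foot j α = x ∧
      ∃ m : Fin N, (m : ℕ) = 0 ∧ (steinerPart T).Reachable v₀ (.valley i j α m) := by
    intro x hx
    obtain ⟨hxi, hx⟩ := mem_erase.1 hx
    obtain ⟨α, m, hm, hα, hr⟩ := (hattach x hx).resolve_left hxi
    exact ⟨α, hα, m, hm, hr⟩
  by_cases hin : ∃ α : Arm n N, ∀ w, (steinerPart T).Reachable v₀ w → arm w = some α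
  · obtain ⟨α, hα⟩ := hin
    refine hle2 ?_
    have : X ⊆ {i, foot j α} := by
      intro y hy
      rcases hattach y hy with rfl | ⟨β, m, -, rfl, hr⟩
      · simp
      · have := hα _ hr
        simp only [arm, Option.some.injEq] at this
        simp [this]
    exact_mod_cast (Finset.card_le_card this).trans Finset.card_le_two
  push Not at hin
  set K := (X.erase i).erase j with hK
  have hXi : #X ≤ #(X.erase i) + 1 := Nat.sub_le_iff_le_add.1 Finset.pred_card_le_card_erase
  have hXj : #(X.erase i) ≤ #K + 1 := Nat.sub_le_iff_le_add.1 Finset.pred_card_le_card_erase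
  rcases K.eq_empty_or_nonempty with hK0 | hKne
  · rw [hK0, card_empty] at hXj
    refine hle2 ?_
    have : #X ≤ 2 := by omega
    exact_mod_cast this
  have : Nonempty (Arm n N) := ⟨.inr i⟩
  have : Nonempty (Fin N) := ⟨⟨0, hN⟩⟩
  choose! α hα m hm hr using hexα
  have hinj : Set.InjOn α (X.erase i) := fun x hx y hy h => by
    rw [← hα x hx, ← hα y hy, h]
  have harm : 3 * N * (#(X.erase i) : ℝ) ≤ ∑ x ∈ X.erase i,
      ∑ e ∈ compEdges T v₀ with InClass (.inr (.inl (α x))) e, cost e := by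
    rw [mul_comm, ← nsmul_eq_mul]
    refine Finset.card_nsmul_le_sum _ _ _ fun x hx => ?_
    obtain ⟨w, hw, hwα⟩ := hin (α x)
    have h1 := abs_sub_le_sum_class hN (fun u v c h hu => h.abs_armPos_sub_le (α x) hu) hw (hr x hx)
    rw [if_neg hwα, if_pos (show arm (.valley i j (α x) (m x)) = some (α x) from rfl), armPos,
      hm x hx, Nat.cast_zero, mul_zero, sub_zero] at h1
    exact (le_abs_self _).trans h1
  have hspine : 4 * N * ((#K : ℝ) - 1) ≤
      ∑ e ∈ compEdges T v₀ with InClass (.inr (.inr ())) e, cost e := by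
    set a := K.min' hKne
    set b := K.max' hKne
    have hpos : ∀ x ∈ K, (steinerPart T).Reachable v₀ (.valley i j (α x) (m x)) ∧
        spinePos (.valley i j (α x) (m x)) = 4 * N * (x : ℕ) := by
      intro x hx
      obtain ⟨hxj, hx⟩ := mem_erase.1 hx
      refine ⟨hr x hx, ?_⟩
      have h1 := hα x hx
      rcases hαx : α x with p | k
      · rw [hαx] at h1
        exact absurd h1.symm hxj
      · rw [hαx] at h1
        simp only [foot, Sum.elim_inr, id] at h1
        subst h1
        simp only [spinePos, pos, Sum.elim_inr]
        push_cast
        ring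
    have ha := hpos a (K.min'_mem hKne)
    have hb := hpos b (K.max'_mem hKne)
    have h1 := abs_sub_le_sum_class hN (fun u v c h hu => h.abs_spinePos_sub_le hu) hb.1 ha.1
    rw [ha.2, hb.2] at h1
    have h2 : K ⊆ Icc a b := fun x hx => mem_Icc.2 ⟨K.min'_le x hx, K.le_max' x hx⟩
    have h3 := Finset.card_le_card h2
    have h4 : a ≤ b := K.min'_le_max' hKne
    rw [Fin.card_Icc] at h3
    have h5 : #K + a ≤ b + 1 := by
      have : (a : ℕ) ≤ b := h4
      omega
    have h6 : (#K : ℝ) + (a : ℕ) ≤ (b : ℕ) + 1 := by exact_mod_cast h5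
    have := (le_abs_self _).trans h1
    nlinarith
  -- the total is at least `6 N #X + 3 N (#X - 1) + 4 N max(0, #X - 3)`
  have htot := sum_classes_le (T := T) (v₀ := v₀) hN
    (X.disjSum (((X.erase i).image α).disjSum {()}))
  rw [Finset.sum_disjSum, Finset.sum_disjSum, Finset.sum_image hinj, Finset.sum_singleton] at htot
  have e1 : (#X : ℝ) ≤ #(X.erase i) + 1 := by exact_mod_cast hXi
  have e2 : (#(X.erase i) : ℝ) ≤ #K + 1 := by exact_mod_cast hXj
  have e3 : (1 : ℝ) ≤ #K := by exact_mod_cast hKne.card_pos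
  nlinarith

end MoatLimit

namespace MoatLimit

open SteinerInstance

variable {n N : ℕ} {T : (graph n N).Subgraph}

theorem gadget_eq_none {v : Vertex n N} : gadget v = none ↔ ∃ x, v = .terminal x := by
  cases v <;> simp [gadget]

open Classical in
/-- A connected subgraph that contains all terminals costs at least as much as `n - 1` direct edges
between terminals: replace each component of its part that avoids the terminals by a star. -/
theorem cost_ge_of_connected (hn : 1 ≤ n) (hN : 1 ≤ N) (hT : T.coe.Connected)
    (hterm : ∀ x, .terminal x ∈ T.verts) :
    12 * N * ((n : ℝ) - 1) ≤ ∑ e with e ∈ T.edgeSet, cost e := by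
  -- the edges `D` between terminals and the stars of the components form a connected graph `G` on
  -- the terminals, with edge set `A`
  let C := (steinerPart T).ConnectedComponent
  let rep : C → Vertex n N := fun c => c.out
  let X : C → Finset (Fin n) := fun c => compTerminals T (rep c)
  let E : C → Finset (Sym2 (Vertex n N)) := fun c => compEdges T (rep c)
  let D : Finset (Sym2 (Fin n)) := {e | e.map .terminal ∈ T.edgeSet}
  have hmem : ∀ v x, gadget v ≠ none → T.Adj (.terminal x) v →
      x ∈ X ((steinerPart T).connectedComponentMk v) := by
    intro v x hv h
    refine mem_compTerminals.2 ⟨v, hv, ?_, h⟩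
    exact SimpleGraph.ConnectedComponent.exact (Quot.out_eq _)
  have : Nonempty (Fin n) := ⟨⟨0, hn⟩⟩
  have hcentre : ∀ c, ∃ z, (X c).Nonempty → z ∈ X c := by
    intro c
    rcases (X c).eq_empty_or_nonempty with h | ⟨z, hz⟩
    · exact ⟨⟨0, hn⟩, fun h' => absurd h h'.ne_empty⟩
    · exact ⟨z, fun _ => hz⟩
  choose z hz using hcentre
  let A : Finset (Sym2 (Fin n)) :=
    D ∪ univ.biUnion fun c => ((X c).erase (z c)).image fun x => s(z c, x)
  let G : SimpleGraph (Fin n) := SimpleGraph.fromEdgeSet A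
  have hstar : ∀ c, ∀ x ∈ X c, G.Reachable (z c) x := by
    intro c x hx
    by_cases h : x = z c
    · rw [h]
    · refine SimpleGraph.Adj.reachable ?_
      rw [SimpleGraph.fromEdgeSet_adj]
      refine ⟨mem_coe.2 (mem_union_right _ (mem_biUnion.2 ⟨c, mem_univ _, ?_⟩)), Ne.symm h⟩
      exact mem_image.2 ⟨x, mem_erase.2 ⟨h, hx⟩, rfl⟩
  have hpair : ∀ c, ∀ x ∈ X c, ∀ y ∈ X c, G.Reachable x y := fun c x hx y hy =>
    (hstar c x hx).symm.trans (hstar c y hy)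
  have hG : G.Connected := by
    refine ⟨fun x₀ y => ?_⟩
    have hr := hT.preconnected ⟨.terminal x₀, hterm x₀⟩ ⟨.terminal y, hterm y⟩
    rw [SimpleGraph.reachable_iff_reflTransGen] at hr
    have key : ∀ v : T.verts,
        Relation.ReflTransGen T.coe.Adj ⟨.terminal x₀, hterm x₀⟩ v →
        (∀ x, v.1 = .terminal x → G.Reachable x₀ x) ∧
        (gadget v.1 ≠ none → ∀ x ∈ X ((steinerPart T).connectedComponentMk v.1),
          G.Reachable x₀ x) := by
      intro v hv
      induction hv with
      | refl =>
        refine ⟨fun x hx => ?_, fun h => absurd rfl h⟩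
        cases hx
        rfl
      | @tail u w _ huw ih =>
        have huw' : T.Adj u.1 w.1 := huw
        by_cases hu : gadget u.1 = none
        · obtain ⟨x, hx⟩ := gadget_eq_none.1 hu
          have hxr := ih.1 x hx
          rw [hx] at huw'
          refine ⟨fun y hy => ?_, fun hw y hy => ?_⟩
          · rw [hy] at huw'
            refine hxr.trans (SimpleGraph.Adj.reachable ?_)
            rw [SimpleGraph.fromEdgeSet_adj]
            refine ⟨mem_coe.2 (mem_union_left _ (mem_filter.2 ⟨mem_univ _, huw'⟩)), ?_⟩
            rintro rfl
            exact huw'.ne rfl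
          · exact hxr.trans (hpair _ x (hmem _ _ hw huw') y hy)
        · refine ⟨fun y hy => ?_, fun hw y hy => ?_⟩
          · rw [hy] at huw'
            exact ih.2 hu y (hmem _ _ hu huw'.symm)
          · refine ih.2 hu y ?_
            have : (steinerPart T).connectedComponentMk u.1 =
                (steinerPart T).connectedComponentMk w.1 :=
              SimpleGraph.ConnectedComponent.sound
                (SimpleGraph.Adj.reachable ⟨huw', hu, hw⟩)
            rwa [this]
    exact (key _ hr).1 y rfl
  have hcard : n ≤ #A + 1 := by
    have h1 := hG.card_vert_le_card_edgeSet_add_one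
    rw [Nat.card_eq_fintype_card, Fintype.card_fin] at h1
    refine h1.trans (Nat.add_le_add_right ?_ 1)
    rw [← Set.ncard_coe_finset]
    refine Set.ncard_le_ncard ?_ (Finset.finite_toSet _)
    rw [SimpleGraph.edgeSet_fromEdgeSet]
    exact Set.sdiff_subset
  have hA : (#A : ℝ) ≤ #D + ∑ c, (#((X c).erase (z c)) : ℝ) := by
    have h1 : #A ≤ #D + ∑ c, #((X c).erase (z c)) := by
      refine (card_union_le _ _).trans (Nat.add_le_add_left ?_ _)
      exact card_biUnion_le.trans (sum_le_sum fun c _ => card_image_le)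
    exact_mod_cast h1
  have hE : ∀ c, 12 * N * (#((X c).erase (z c)) : ℝ) ≤ ∑ e ∈ E c, cost e := by
    intro c
    rcases (X c).eq_empty_or_nonempty with h | h
    · rw [h, erase_empty, card_empty, Nat.cast_zero, mul_zero]
      exact sum_nonneg fun e he => (cost_pos hN (T.edgeSet_subset (mem_filter.1 he).2.1)).le
    · have h1 := card_erase_add_one (hz c h)
      have h2 : (#((X c).erase (z c)) : ℝ) + 1 = #(X c) := by exact_mod_cast h1
      obtain ⟨x, hx⟩ := h
      obtain ⟨v, hv, hr, -⟩ := mem_compTerminals.1 hx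
      have h0 : gadget (rep c) ≠ none := by
        intro h0
        rw [SimpleGraph.reachable_iff_reflTransGen] at hr
        rcases hr.cases_head with rfl | ⟨w, hw, -⟩
        · exact hv h0
        · exact hw.2.1 h0
      obtain ⟨⟨i, j⟩, h0⟩ := Option.ne_none_iff_exists'.1 h0
      have h3 := comp_cost_ge (T := T) hN h0
      have : compTerminals T (rep c) = X c := rfl
      rw [this, ← h2] at h3
      linarith
  have hsum : ∑ e ∈ D, cost (e.map (Vertex.terminal (N := N))) + ∑ c, ∑ e ∈ E c, cost e ≤
      ∑ e with e ∈ T.edgeSet, cost (n := n) (N := N) e := by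
    have hinj : Set.InjOn (Sym2.map (Vertex.terminal (n := n) (N := N))) D :=
      (Sym2.map.injective fun _ _ h => (terminalEmb n N).injective h).injOn
    have hdisj : Disjoint (D.image (Sym2.map (Vertex.terminal (N := N)))) (univ.biUnion E) := by
      refine disjoint_left.2 fun e he he' => ?_
      obtain ⟨e, -, rfl⟩ := mem_image.1 he
      obtain ⟨c, -, hc⟩ := mem_biUnion.1 he'
      obtain ⟨-, -, v, hv, hv', -⟩ := mem_filter.1 hc
      obtain ⟨x, -, rfl⟩ := Sym2.mem_map.1 hv
      exact hv' rfl
    have hdisjE : Set.PairwiseDisjoint (↑(univ : Finset C)) E := by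
      intro c _ c' _ hcc
      refine disjoint_left.2 fun e he he' => hcc ?_
      obtain ⟨-, hT, v, hv, hv', hr⟩ := mem_filter.1 he
      obtain ⟨-, -, w, hw, hw', hr'⟩ := mem_filter.1 he'
      have hvw : (steinerPart T).Reachable v w := by
        induction e with
        | _ a b =>
          have hab : T.Adj a b := hT
          rcases Sym2.mem_iff.1 hv with rfl | rfl <;> rcases Sym2.mem_iff.1 hw with rfl | rfl
          · rfl
          · exact SimpleGraph.Adj.reachable ⟨hab, hv', hw'⟩
          · exact SimpleGraph.Adj.reachable ⟨hab.symm, hv', hw'⟩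
          · rfl
      have h1 := SimpleGraph.ConnectedComponent.sound (hr.trans (hvw.trans hr'.symm))
      have h2 : ∀ c : C, (steinerPart T).connectedComponentMk (rep c) = c := fun c => Quot.out_eq c
      rwa [h2, h2] at h1
    rw [← sum_image hinj, ← sum_biUnion hdisjE, ← sum_union hdisj]
    refine sum_le_sum_of_subset_of_nonneg (fun e he => ?_) fun e he _ =>
      (cost_pos hN (T.edgeSet_subset (mem_filter.1 he).2)).le
    rcases mem_union.1 he with he | he
    · obtain ⟨e, heD, rfl⟩ := mem_image.1 he
      exact mem_filter.2 ⟨mem_univ _, (mem_filter.1 heD).2⟩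
    · obtain ⟨c, -, hc⟩ := mem_biUnion.1 he
      exact mem_filter.2 ⟨mem_univ _, (mem_filter.1 hc).2.1⟩
  have hD : ∑ e ∈ D, cost (e.map (Vertex.terminal (N := N))) = #D * (12 * N : ℝ) := by
    rw [← nsmul_eq_mul, ← sum_const]
    refine sum_congr rfl fun e he => ?_
    induction e with
    | _ x y =>
      have h : T.Adj (.terminal x) (.terminal y) := (mem_filter.1 he).2
      refine cost_terminal ?_
      rintro rfl
      exact h.ne rfl
  have h1 : ∑ c, 12 * N * (#((X c).erase (z c)) : ℝ) ≤ ∑ c, ∑ e ∈ E c, cost e :=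
    sum_le_sum fun c _ => hE c
  rw [← mul_sum] at h1
  have h2 : (n : ℝ) ≤ #A + 1 := by exact_mod_cast hcard
  have h3 : 12 * N * ((n : ℝ) - 1) ≤ 12 * N * (#D + ∑ c, (#((X c).erase (z c)) : ℝ)) := by
    gcongr
    linarith
  linarith

variable {hn : 1 ≤ n} {hN : 1 ≤ N}

/-- There is a Steiner tree that uses direct edges between the terminals only. -/
theorem exists_steinerTree_cost_le : ∃ T : (inst n N hn hN).graph.Subgraph,
    (inst n N hn hN).IsSteinerTree T ∧ (inst n N hn hN).subgraphCost T ≤ 12 * N * (n - 1) := by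
  classical
  have : Nonempty (Fin n) := ⟨⟨0, hn⟩⟩
  obtain ⟨S, -, hS⟩ := (SimpleGraph.connected_top (V := Fin n)).exists_isTree_le
  let T : (inst n N hn hN).graph.Subgraph :=
    { verts := Set.range Vertex.terminal
      Adj := fun u v => ∃ x y, u = .terminal x ∧ v = .terminal y ∧ S.Adj x y
      adj_sub := by
        rintro _ _ ⟨x, y, rfl, rfl, h⟩
        exact (Link.direct h.ne).adj
      edge_vert := by
        rintro _ _ ⟨x, y, rfl, rfl, h⟩
        exact ⟨x, rfl⟩
      symm := ⟨by
        rintro _ _ ⟨x, y, rfl, rfl, h⟩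
        exact ⟨y, x, rfl, rfl, h.symm⟩⟩ }
  have hinj : Function.Injective (Vertex.terminal (n := n) (N := N)) := (terminalEmb n N).injective
  let f : S ≃g T.coe :=
    { toEquiv := Equiv.ofInjective _ hinj
      map_rel_iff' := by
        intro x y
        constructor
        · rintro ⟨x', y', hx, hy, h⟩
          rwa [hinj hx, hinj hy]
        · intro h
          exact ⟨x, y, rfl, rfl, h⟩ }
  refine ⟨T, ⟨f.isTree_iff.1 hS, fun v hv => ?_⟩, ?_⟩
  · obtain ⟨x, rfl⟩ := mem_terminals.1 hv
    exact ⟨x, rfl⟩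
  · have hsub : ({e | e ∈ T.edgeSet} : Finset (Sym2 (Vertex n N))) ⊆
        S.edgeFinset.image (Sym2.map Vertex.terminal) := by
      intro e he
      induction e with
      | _ u v =>
        obtain ⟨x, y, rfl, rfl, h⟩ := (mem_filter.1 he).2
        exact mem_image.2 ⟨s(x, y), SimpleGraph.mem_edgeFinset.2 h, rfl⟩
    have hcard : #({e | e ∈ T.edgeSet} : Finset (Sym2 (Vertex n N))) + 1 ≤ n := by
      have h1 := hS.card_edgeFinset
      rw [Fintype.card_fin] at h1
      have := (card_le_card hsub).trans card_image_le
      omega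
    have hcost : ∀ e ∈ ({e | e ∈ T.edgeSet} : Finset (Sym2 (Vertex n N))),
        (inst n N hn hN).cost e ≤ 12 * N := by
      intro e he
      induction e with
      | _ u v =>
        obtain ⟨x, y, rfl, rfl, h⟩ := (mem_filter.1 he).2
        exact (cost_terminal h.ne).le
    have h2 := sum_le_card_nsmul _ _ _ hcost
    rw [nsmul_eq_mul] at h2
    have h3 : (#({e | e ∈ T.edgeSet} : Finset (Sym2 (Vertex n N))) : ℝ) + 1 ≤ n := by
      exact_mod_cast hcard
    rw [subgraphCost]
    have hN0 : (0 : ℝ) ≤ N := Nat.cast_nonneg _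
    nlinarith

theorem OPT_eq : (inst n N hn hN).OPT = 12 * N * (n - 1) := by
  have hge : ∀ T : (inst n N hn hN).graph.Subgraph, (inst n N hn hN).IsSteinerTree T →
      12 * N * ((n : ℝ) - 1) ≤ (inst n N hn hN).subgraphCost T := fun T hT =>
    cost_ge_of_connected hn hN hT.1.connected fun x => hT.2 _ (terminal_mem x)
  obtain ⟨T, hT, hle⟩ := exists_steinerTree_cost_le (hn := hn) (hN := hN)
  refine le_antisymm ?_ ?_
  · have h : BddBelow {x | ∃ T, (inst n N hn hN).IsSteinerTree T ∧
        (inst n N hn hN).subgraphCost T = x} := by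
      refine ⟨12 * N * (n - 1), ?_⟩
      rintro _ ⟨T, hT, rfl⟩
      exact hge T hT
    exact (csInf_le h ⟨T, hT, rfl⟩).trans hle
  · refine le_csInf ⟨_, T, hT, rfl⟩ ?_
    rintro _ ⟨T, hT, rfl⟩
    exact hge T hT

end MoatLimit

open SteinerInstance MoatLimit in
theorem theorem3 (ε : ℝ) (hε : 0 < ε) :
    ∃ (V : Type) (_ : Fintype V) (_ : DecidableEq V) (I : SteinerInstance V),
      2 ≤ #I.terminals ∧ I.MSTOptimal ∧
      ∀ r ∈ I.terminals, ∀ y : Finset V → ℝ, I.IsMergePlanBased y →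
        I.dualValue r y ≤ (7 / 12 + ε) * I.TMST := by
  -- the terms of lower order are at most `13 k + 20`, compared to `12 ε (k + 1) (k + 2)`
  obtain ⟨k, hk⟩ := exists_nat_ge (2 / ε)
  have hkε : 2 ≤ k * ε := (div_le_iff₀ hε).1 hk
  have hn : 1 ≤ k + 2 := by omega
  refine ⟨Vertex (k + 2) (k + 2), inferInstance, inferInstance, inst (k + 2) (k + 2) hn hn, ?_,
    TMST_eq.trans OPT_eq.symm, ?_⟩
  · rw [card_terminals]
    omega
  · rintro r hr y ⟨-, M, T, hrun, -⟩
    refine (dualValue_le (by omega) hrun hr).trans ?_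
    rw [TMST_eq]
    push_cast
    have hk0 : (0 : ℝ) ≤ k := Nat.cast_nonneg _
    nlinarith
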